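/- A *pairing* of a finite set is a partition of it into two-element blocks. A *non-oriented map* $M=(\mathcal B,\mathcal W,\mathcal E)$ is a triple of pairings of the same finite set $X$ of *edge-sides*. Its edges are the blocks of $\mathcal E$. Its black vertices, white vertices, faces and connected components correspond to the orbits on $X$ of the groups generated by (the involutions corresponding to) $\{\mathcal B,\mathcal E\}$, $\{\mathcal W,\mathcal E\}$, $\{\mathcal B,\mathcal W\}$ and $\{\mathcal B,\mathcal W,\mathcal E\}$, respectively. Write $V_\bullet(M)$, $V_\circ(M)$ for the sets of black and white vertices and $V(M)$ for the set of all vertices. A vertex and an edge are incident if they share an edge-side. Removing an edge $E$ gives the map $M\setminus E$ on $X\setminus E$: in $\mathcal B$ and in $\mathcal W$ the block equal to $E$, if there is one, is deleted, and otherwise the two blocks meeting $E$ are replaced by the pair formed by their elements outside $E$. Let $\gamma$ be a variable. An edge $E$ of $M$ has weight $\operatorname{mon}_{M,E}=\frac12$ if its two sides lie on different faces; if they lie on the same face, the weight is $\gamma$ when a walk along the boundary of that face traverses the two sides in the same direction, and $1$ when it traverses them in opposite directions. For a map $M$ with $n$ edges put $$\operatorname{mon}_M(\gamma)=\frac1{n!}\sum_{(E_1,\dots,E_n)}\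 \prod_{i=0}^{n-1}\operatorname{mon}_{M_i,E_{i+1}},\qquad M_i=M\setminus\{E_1,\dots,E_i\},$$ where the sum runs over all orderings of the edges of $M$. Let $\operatorname{mon}^{\mathrm{top}}_M$ be the probability that, for a uniformly random ordering, each of the maps $M_0,\dots,M_n$ has as many faces as connected components. Let $A$ be an indeterminate and $\gamma=A^{-1}-A$. For a Young diagram $\lambda$ let $$\mathfrak N_M(\lambda)=\frac{A^{|V_\circ(M)|}}{(-A)^{|V_\bullet(M)|}}\,N_M(\lambda)\in\mathbb Q[A,A^{-1}],$$ where $N_M(\lambda)$ is the number of embeddings, i.e. of functions which map white vertices of $M$ to columns of $\lambda$, black vertices to rows and edges to boxes, and preserve incidence. Fix $n\ge1$ and a bicolored polygon with $2n$ labeled edges, i.e. pairings $\mathcal B,\mathcal W$ of a $2n$-element set $X$ for which the group generated by them is transitive. Below, the sum over non-oriented maps $M$ of face-type $(n)$ is the sum over $M=(\mathcal B,\mathcal W,\mathcal E)$ for all pairings $\mathcal E$ of $X$. The orientability generating series is $$\widehat{\mathrm{Ch}}_n(\lambda)=-\sum_M \operatorname{mon}_M(\gamma)\,\mathfrak N_M(\lambda).$$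 A *Stanley polynomial* of a function $F$ from Young diagrams to $\mathbb Q[A,A^{-1}]$ is a family of polynomials $\mathrm{St}_\ell(\gamma;p_1,\dots,p_\ell;q_1,\dots,q_\ell)$, $\ell\ge0$, with rational coefficients, such that for all $\ell$ and all non-negative integers $p'_1,\dots,p'_\ell$ and $q'_1\ge\dots\ge q'_\ell$ $$F(P'\times Q')=\mathrm{St}_\ell\bigl(A^{-1}-A;\ A^{-1}p'_1,\dots,A^{-1}p'_\ell;\ Aq'_1,\dots,Aq'_\ell\bigr),$$ where $P'\times Q'$ is the Young diagram with $p'_1$ rows of length $q'_1$, then $p'_2$ rows of length $q'_2$, and so on. All $2\ell+1$ variables have degree $1$. **Corollary 5.5.** For each integer $n\ge1$ the function $\widehat{\mathrm{Ch}}_n$ has a unique Stanley polynomial, and this polynomial has degree at most $n+1$. Its homogeneous part of degree $n+1$ is the Stanley polynomial of exactly one function $\widehat{\mathrm{Ch}}^{\mathrm{top}}_n$ on the set of Young diagrams, and this function is $$\widehat{\mathrm{Ch}}^{\mathrm{top}}_n=-\sum_M \operatorname{mon}^{\mathrm{top}}_M\,\gamma^{\,n+1-|V(M)|}\,\mathfrak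 N_M,$$ where the sum runs over the non-oriented maps $M$ of face-type $(n)$; each of them satisfies $|V(M)|\le n+1$. -/

import Mathlib

open Polynomial

/-- A pairing (partition into two-element blocks) of the finite set `S ⊆ α`, encoded by the map
sending each element of `S` to the other element of its block and fixing everything outside `S`. -/
structure Pairing {α : Type*} (S : Finset α) where
  toPerm : Equiv.Perm α
  invol : ∀ x, toPerm (toPerm x) = x
  ne_iff : ∀ x, toPerm x ≠ x ↔ x ∈ S

namespace Pairing

theorem toPerm_injective {α : Type*} {S : Finset α} :
    Function.Injective (Pairing.toPerm : Pairing S → Equiv.Perm α) := by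
  rintro ⟨f, _, _⟩ ⟨g, _, _⟩ h
  cases h
  rfl

noncomputable instance {α : Type*} [DecidableEq α] [Fintype α] (S : Finset α) :
    Fintype (Pairing S) :=
  Fintype.ofInjective _ toPerm_injective

/-- The partner function of the pairing obtained from `σ` when the edge `e`, a block of the
pairing `τ`, is removed. If `x` was paired by `σ` with one edge-side `y` of `e`, then `x` is now
paired with the former `σ`-partner of the other edge-side of `e`. -/
def removeFun {α : Type*} [DecidableEq α] {S : Finset α} (σ τ : Pairing S) (e : Sym2 α)
    (x : α) : α :=
  if x ∈ e then x
  else if σ.toPerm x ∈ e then σ.toPerm (τ.toPerm (σ.toPerm x))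
  else σ.toPerm x

section
variable {α : Type*} [DecidableEq α] {S : Finset α} (σ τ : Pairing S) {e : Sym2 α}

theorem removeFun_facts (he : ∃ a ∈ S, s(a, τ.toPerm a) = e) (x : α) (hx : x ∉ e) :
    removeFun σ τ e x ∉ e ∧ removeFun σ τ e (removeFun σ τ e x) = x ∧
      (removeFun σ τ e x ≠ x ↔ x ∈ S) := by
  obtain ⟨a, ha, rfl⟩ := he
  have hs := σ.invol
  have ht := τ.invol
  have hsn := σ.ne_iff
  have htn := τ.ne_iff
  have hbn : τ.toPerm a ≠ a := (htn a).2 ha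
  have hb : τ.toPerm a ∈ S := by
    rw [← htn, ht]
    exact hbn.symm
  have hsa : σ.toPerm a ≠ a := (hsn a).2 ha
  have hsb : σ.toPerm (τ.toPerm a) ≠ τ.toPerm a := (hsn _).2 hb
  have hta := ht a
  have hsx := hs x
  have hsa2 := hs a
  have hsb2 := hs (τ.toPerm a)
  have hnx := hsn x
  simp only [removeFun, Sym2.mem_iff] at hx ⊢
  grind

/-- The pairing obtained from `σ` by removing the edge `e`. -/
def remove (he : ∃ a ∈ S, s(a, τ.toPerm a) = e) : Pairing (S.filter (fun x => x ∉ e)) where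
  toPerm := Function.Involutive.toPerm (removeFun σ τ e) (fun x => by
    by_cases hx : x ∈ e
    · simp [removeFun, hx]
    · exact (removeFun_facts σ τ he x hx).2.1)
  invol x := by
    change removeFun σ τ e (removeFun σ τ e x) = x
    by_cases hx : x ∈ e
    · simp [removeFun, hx]
    · exact (removeFun_facts σ τ he x hx).2.1
  ne_iff x := by
    change removeFun σ τ e x ≠ x ↔ _
    by_cases hx : x ∈ e
    · simp [removeFun, hx]
    · simpa [hx] using (removeFun_facts σ τ he x hx).2.2

end

end Pairing

/-- The orbits, contained in `S`, of the group generated by a set `s` of permutations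
(each of which is supposed to preserve `S`). -/
def orbitsOn {α : Type*} (s : Set (Equiv.Perm α)) (S : Finset α) : Set (Set α) :=
  (fun x => MulAction.orbit (Subgroup.closure s) x) '' (S : Set α)

/-- The polygons of `𝓛(B, W)`: edge-sides paired by `B` share a black vertex of a polygon and
edge-sides paired by `W` share a white one; a polygon is the set of its edge-sides. -/
def polygons {α : Type*} {S : Finset α} (B W : Pairing S) : Set (Set α) :=
  orbitsOn {B.toPerm, W.toPerm} S

/-- A (possibly disconnected) non-oriented map with edge-sides labelled by the elements of a finite
set `base`: a triple of pairings of `base`. The pairings `black` and `white` tell which edge-sides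
share a corner at a black (white) vertex, and `edge` tells which edge-sides form an edge. -/
structure NonorientedMap (α : Type*) where
  base : Finset α
  black : Pairing base
  white : Pairing base
  edge : Pairing base

namespace NonorientedMap

section
variable {α : Type*}

/-- The faces (each given by the set of its edge-sides). -/
def faces (M : NonorientedMap α) : Set (Set α) := polygons M.black M.white

/-- The connected components (each given by the set of its edge-sides). -/
def components (M : NonorientedMap α) : Set (Set α) :=
  orbitsOn {M.black.toPerm, M.white.toPerm, M.edge.toPerm} M.base

/-- The black vertices (each given by the set of edge-sides touching it). -/
def blackVertices (M : NonorientedMap α) : Set (Set α) :=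
  orbitsOn {M.black.toPerm, M.edge.toPerm} M.base

/-- The white vertices (each given by the set of edge-sides touching it). -/
def whiteVertices (M : NonorientedMap α) : Set (Set α) :=
  orbitsOn {M.white.toPerm, M.edge.toPerm} M.base

/-- The number `|V(M)|` of vertices. -/
noncomputable def numVertices (M : NonorientedMap α) : ℕ :=
  M.whiteVertices.ncard + M.blackVertices.ncard

/-- An edge-side `x` and its partner lie on two different faces. -/
def IsInterface (M : NonorientedMap α) (e : Sym2 α) : Prop :=
  ∃ x ∈ e, M.edge.toPerm x ∉
    MulAction.orbit (Subgroup.closure {M.black.toPerm, M.white.toPerm}) x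

/-- The two edge-sides of `e` lie on the same face and a walk along the boundary of that face
traverses them in the same direction. The colours of the vertices met by the walk alternate, so
consecutive edge-sides are traversed in opposite directions (with respect to the colours), and the
edge-sides traversed in the same direction as `x` are those reached from `x` in an even number of
steps, i.e. the ones in the cycle of `x` under the product of the two corner pairings. -/
def IsTwisted (M : NonorientedMap α) (e : Sym2 α) : Prop :=
  ∃ x ∈ e, (M.white.toPerm * M.black.toPerm).SameCycle x (M.edge.toPerm x)

open Classical in
/-- The weight of the edge `e` of `M`, a polynomial in `γ` (written `X`): `1/2` for an interface
edge, `γ` for a twisted one and `1` for a straight one (same face, opposite directions). -/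
noncomputable def edgeWeight (M : NonorientedMap α) (e : Sym2 α) : ℚ[X] :=
  if M.IsInterface e then C (1 / 2) else if M.IsTwisted e then X else 1

/-- A vertex and an edge are incident if the edge-sides of the edge touch the vertex. -/
def Incident (v : Set α) (e : Sym2 α) : Prop := ∃ x ∈ e, x ∈ v

end

section
variable {α : Type*} [DecidableEq α]

/-- The edges, each given by the unordered pair of its two edge-sides. -/
def edges (M : NonorientedMap α) : Finset (Sym2 α) :=
  M.base.image (fun x => s(x, M.edge.toPerm x))

/-- The map `M` with the edge `e` removed (together with the vertices that become isolated);
if `e` is not an edge of `M`, nothing happens. -/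
def remove (M : NonorientedMap α) (e : Sym2 α) : NonorientedMap α :=
  if h : e ∈ M.edges then
    have he : ∃ a ∈ M.base, s(a, M.edge.toPerm a) = e := Finset.mem_image.1 h
    { base := M.base.filter (fun x => x ∉ e)
      black := M.black.remove M.edge he
      white := M.white.remove M.edge he
      edge := M.edge.remove M.edge he }
  else M

/-- The histories of `M`: the linear orders on the set of edges, given as the lists in which every
edge occurs exactly once. -/
def histories (M : NonorientedMap α) : Finset (List (Sym2 α)) := M.edges.val.lists.toFinset

/-- The product of the weights of the edges of `M`, which are removed one by one in the given
order, each edge being weighted in the map from which it is about to be removed. -/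
noncomputable def historyWeight : NonorientedMap α → List (Sym2 α) → ℚ[X]
  | _, [] => 1
  | M, e :: l => M.edgeWeight e * historyWeight (M.remove e) l

/-- The measure of non-orientability `mon_M(γ)`. -/
noncomputable def mon (M : NonorientedMap α) : ℚ[X] :=
  C (1 / (M.edges.card.factorial : ℚ)) * ∑ l ∈ M.histories, M.historyWeight l

/-- When the edges are removed one by one in the given order, the number of faces is at each
step equal to the number of connected components. -/
def IsTopDegreeHistory : NonorientedMap α → List (Sym2 α) → Prop
  | M, [] => M.faces.ncard = M.components.ncard
  | M, e :: l => M.faces.ncard = M.components.ncard ∧ IsTopDegreeHistory (M.remove e) l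

open Classical in
/-- The quantity `mon^top_M`: the probability that a uniformly random history has the above
property. -/
noncomputable def monTop (M : NonorientedMap α) : ℚ :=
  ((M.histories.filter (fun l => M.IsTopDegreeHistory l)).card : ℚ) / (M.histories.card : ℚ)

/-- An embedding of the bicoloured graph of `M` into a Young diagram: white vertices go to
columns, black vertices to rows and edges to boxes, and incidence is preserved.
A cell `(i, j)` lies in row `i` and column `j`. -/
structure Embedding (M : NonorientedMap α) (lam : YoungDiagram) where
  column : M.whiteVertices → {j : ℕ // (0, j) ∈ lam}
  row : M.blackVertices → {i : ℕ // (i, 0) ∈ lam}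
  box : {e // e ∈ M.edges} → {c : ℕ × ℕ // c ∈ lam}
  white_incident : ∀ v e, Incident v.1 e.1 → (box e).1.2 = (column v).1
  black_incident : ∀ v e, Incident v.1 e.1 → (box e).1.1 = (row v).1

/-- The number `N_M(λ)` of embeddings. -/
noncomputable def numEmbeddings (M : NonorientedMap α) (lam : YoungDiagram) : ℕ :=
  Nat.card (M.Embedding lam)

open LaurentPolynomial in
/-- The normalized number of embeddings `A^{|V_∘|} (-A)^{-|V_•|} N_M(λ)`, a Laurent polynomial in
the indeterminate `A` (written `T 1`). -/
noncomputable def normEmbeddings (M : NonorientedMap α) (lam : YoungDiagram) :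
    LaurentPolynomial ℚ :=
  (-1) ^ M.blackVertices.ncard *
    T ((M.whiteVertices.ncard : ℤ) - (M.blackVertices.ncard : ℤ)) * (M.numEmbeddings lam : LaurentPolynomial ℚ)

end

end NonorientedMap

/-- `γ = A⁻¹ - A`, as a Laurent polynomial in `A`. -/
noncomputable def gammaA : LaurentPolynomial ℚ :=
  LaurentPolynomial.T (-1) - LaurentPolynomial.T 1

/-- The map obtained from the labelled polygons given by `B` and `W` by gluing their edges
according to the pairing `E`. -/
def gluedMap {α : Type*} [Fintype α] (B W E : Pairing (Finset.univ : Finset α)) :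
    NonorientedMap α where
  base := Finset.univ
  black := B
  white := W
  edge := E

/-- The orientability generating series `λ ↦ (-1)^{ℓ(π)} ∑_M mon_M(γ) 𝔑_M(λ)`. Here the
collection of polygons, whose half-lengths are the parts of `π`, is given by `B` and `W` (so that
`ℓ(π)` is the number of polygons), and the sum over the maps with face-type `π` runs over all
ways of gluing their edges in pairs. -/
noncomputable def orientabilitySeries {α : Type*} [DecidableEq α] [Fintype α]
    (B W : Pairing (Finset.univ : Finset α)) (lam : YoungDiagram) : LaurentPolynomial ℚ :=
  (-1) ^ (polygons B W).ncard *
    ∑ E : Pairing (Finset.univ : Finset α),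
      aeval gammaA (gluedMap B W E).mon * (gluedMap B W E).normEmbeddings lam

/-- The row lengths of the multirectangular diagram with `p i` rows of length `q i`. -/
def multirectRows {l : ℕ} (p q : Fin l → ℕ) : List ℕ :=
  (List.ofFn (fun i => List.replicate (p i) (q i))).flatten

theorem multirectRows_sorted {l : ℕ} (p q : Fin l → ℕ) (hq : Antitone q) :
    (multirectRows p q).SortedGE := by
  rw [List.sortedGE_iff_pairwise, multirectRows, List.pairwise_flatten]
  refine ⟨?_, ?_⟩
  · intro r hr
    obtain ⟨i, rfl⟩ := (List.mem_ofFn' _ _).1 hr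
    exact List.pairwise_replicate.2 (Or.inr le_rfl)
  · rw [List.pairwise_ofFn]
    intro i j hij x hx y hy
    rw [List.eq_of_mem_replicate hx, List.eq_of_mem_replicate hy]
    exact hq hij.le

/-- The multirectangular Young diagram: `p 0` rows of length `q 0`, then `p 1` rows of length
`q 1`, and so on. -/
def multirect {l : ℕ} (p q : Fin l → ℕ) (hq : Antitone q) : YoungDiagram :=
  YoungDiagram.ofRowLens (multirectRows p q) (multirectRows_sorted p q hq)

/-- The `2l + 1` variables `γ, p_1, …, p_l, q_1, …, q_l`. -/
inductive StanleyVar (l : ℕ) : Type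
  | gamma : StanleyVar l
  | p (i : Fin l) : StanleyVar l
  | q (i : Fin l) : StanleyVar l

open LaurentPolynomial in
/-- The values of the variables when the isotropic coordinates `p'_i = A p_i`, `q'_i = q_i / A`
are `p` and `q`: `γ = A⁻¹ - A`, `p_i = p'_i A⁻¹` and `q_i = q'_i A`. -/
noncomputable def stanleyValue {l : ℕ} (p q : Fin l → ℕ) : StanleyVar l → LaurentPolynomial ℚ
  | .gamma => gammaA
  | .p i => (p i : LaurentPolynomial ℚ) * T (-1)
  | .q i => (q i : LaurentPolynomial ℚ) * T 1

/-- The family `St` (one polynomial for each number `l` of rectangles) is the Stanley polynomial of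
the function `F` on the set of Young diagrams. -/
def IsStanleyPolynomial (F : YoungDiagram → LaurentPolynomial ℚ)
    (St : (l : ℕ) → MvPolynomial (StanleyVar l) ℚ) : Prop :=
  ∀ (l : ℕ) (p q : Fin l → ℕ) (hq : Antitone q),
    F (multirect p q hq) = MvPolynomial.aeval (stanleyValue p q) (St l)

/-! The weight of a map is governed by its first Betti number b = |E| - |V| + |C|, which never
increases when an edge is removed and vanishes for the empty map. Removing a twisted edge, the only
kind of weight γ, lowers b by exactly one. Hence the weight of every history has degree at most b in
γ (`coeff_historyWeight_eq_zero`).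

If there are as many faces as components, no edge is an interface. A twisted removal then keeps both
numbers, while a straight one keeps b + |F| - |C| = |E| - |V| + |F|. So b survives a straight
removal exactly when |F| = |C| persists, and the coefficient of γ^b is 1 for the histories counted
by `monTop` and 0 for the others (`coeff_historyWeight_eq`). These facts rest on following the
boundary of a face past a removed edge (`orb_remove_eq_of_sameCycle`,
`orb_remove_ne_of_not_sameCycle`).

For a glued polygon, b = n + 1 - |V|; nonnegativity of b is the bound on |V|. On multirectangular
diagrams the normalized number of embeddings is a homogeneous polynomial of degree |V| in p and q
(`normEmbeddings_multirect`, `isHomogeneous_stanleyTerm`). Each map therefore contributes degree at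
most n + 1, and its part of that degree is `monTop` times γ^b times this polynomial.

Uniqueness of the polynomial holds because the admissible values of γ, p, q are Zariski dense
(`eq_zero_of_aeval_stanleyValue`); uniqueness of the function, because every Young diagram is
multirectangular. -/

/-! ### Orbits and invariant functions -/

/-- The orbit of `x` under the group generated by `s`. -/
abbrev orb {α : Type*} (s : Set (Equiv.Perm α)) (x : α) : Set α :=
  MulAction.orbit (Subgroup.closure s) x

section Orbits
variable {α : Type*} {s : Set (Equiv.Perm α)}

theorem orb_apply {f : Equiv.Perm α} (hf : f ∈ s) (x : α) : orb s (f x) = orb s x :=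
  MulAction.orbit_eq_iff.2 ⟨⟨f, Subgroup.subset_closure hf⟩, rfl⟩

/-- Orbits are compared below by exhibiting functions invariant under the generators, which avoids
handling words in them. -/
theorem eq_of_mem_orb {β : Type*} {κ : α → β} (h : ∀ f ∈ s, ∀ x, κ (f x) = κ x) {x y : α}
    (hy : y ∈ orb s x) : κ y = κ x := by
  obtain ⟨⟨g, hg⟩, rfl⟩ := hy
  change κ (g x) = κ x
  revert x
  induction hg using Subgroup.closure_induction with
  | mem f hf => exact fun {x} => h f hf x
  | one => exact fun {x} => rfl
  | mul f g _ _ hf hg => exact fun {x} => (hf (x := g x)).trans hg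
  | inv f _ hf => exact fun {x} => by simpa using (hf (x := f⁻¹ x)).symm

theorem eq_of_orb_eq {β : Type*} {κ : α → β} (h : ∀ f ∈ s, ∀ x, κ (f x) = κ x) {x y : α}
    (hy : orb s x = orb s y) : κ x = κ y :=
  eq_of_mem_orb h (hy ▸ MulAction.mem_orbit_self x)

end Orbits

theorem ncard_image_eq_of_iff {α β γ : Type*} {f : α → β} {g : α → γ} {S : Set α}
    (h : ∀ x ∈ S, ∀ y ∈ S, f x = f y ↔ g x = g y) : (f '' S).ncard = (g '' S).ncard := by
  refine Set.ncard_congr (fun b hb => g hb.choose) ?_ ?_ ?_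
  · intro b hb
    exact ⟨_, hb.choose_spec.1, rfl⟩
  · intro b b' hb hb' hg
    rw [← hb.choose_spec.2, ← hb'.choose_spec.2]
    exact (h _ hb.choose_spec.1 _ hb'.choose_spec.1).2 hg
  · rintro _ ⟨x, hx, rfl⟩
    have hb : f x ∈ f '' S := ⟨x, hx, rfl⟩
    exact ⟨f x, hb, (h _ hb.choose_spec.1 _ hx).1 hb.choose_spec.2⟩

-- The classes of `f` are those of `g` with the class of `c'` merged into that of `c`, so one class
-- is lost unless the two already coincide.
open Classical in
theorem ncard_image_of_merge {α β γ : Type*} {f : α → β} {g : α → γ} {S : Set α} (hS : S.Finite)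
    {c c' : α} (hc : c ∈ S) (hc' : c' ∈ S)
    (h : ∀ x ∈ S, ∀ y ∈ S, f x = f y ↔
      (if g x = g c' then g c else g x) = (if g y = g c' then g c else g y)) :
    (g '' S).ncard = (f '' S).ncard + if g c = g c' then 0 else 1 := by
  by_cases hcc : g c = g c'
  · rw [if_pos hcc, add_zero]
    refine (ncard_image_eq_of_iff fun x hx y hy => ?_).symm
    rw [h x hx y hy]
    split_ifs <;> simp_all
  · rw [if_neg hcc, ncard_image_eq_of_iff h]
    have : (fun x => if g x = g c' then g c else g x) '' S = (g '' S) \ {g c'} := by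
      ext z
      constructor
      · rintro ⟨x, hx, rfl⟩
        dsimp only
        split_ifs with hx'
        · exact ⟨Set.mem_image_of_mem g hc, hcc⟩
        · exact ⟨⟨x, hx, rfl⟩, hx'⟩
      · rintro ⟨⟨x, hx, rfl⟩, hx'⟩
        exact ⟨x, hx, if_neg hx'⟩
    rw [this, Set.ncard_sdiff_singleton_add_one (Set.mem_image_of_mem g hc') (hS.image g)]

/-! ### Orbits after the removal of an edge -/

namespace Pairing

theorem mem_apply_iff {α : Type*} {S : Finset α} (σ : Pairing S) (x : α) : σ.toPerm x ∈ S ↔ x ∈ S := by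
  rw [← σ.ne_iff, ← σ.ne_iff, σ.invol]
  exact ne_comm

section Removal
variable {α : Type*} [DecidableEq α] {S : Finset α} {τ : Pairing S} {a : α}

/-- A rerouted partner is reached by applying σ, τ, σ in turn, and here τ only exchanges the two
sides of the removed edge. -/
theorem removeFun_invariant {β : Type*} {κ : α → β} {σ : Pairing S}
    (hσ : ∀ x, κ (σ.toPerm x) = κ x) (hτ : κ (τ.toPerm a) = κ a) (x : α) :
    κ (removeFun σ τ s(a, τ.toPerm a) x) = κ x := by
  unfold removeFun
  split_ifs with h1 h2
  · rfl
  · rw [hσ, ← hσ x]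
    rcases Sym2.mem_iff.1 h2 with h | h
    · rw [h, hτ]
    · rw [h, hτ, τ.invol]
  · exact hσ x

/-- Invariants of the smaller map extend to the larger one by giving both sides of the edge the
value at `z`. The elements outside the edge whose σ-partner is in it are σ a and σ (τ a); they
become partners, so they share a value, and `hz` says it is that of `z`. If the edge is a block of
σ, there are no such elements. -/
theorem invariant_of_removeFun {β : Type*} {κ : α → β} {σ : Pairing S} {z : α}
    (hσ : ∀ x, κ (removeFun σ τ s(a, τ.toPerm a) x) = κ x)
    (hz : σ.toPerm a = τ.toPerm a ∨ κ (σ.toPerm a) = κ z) (x : α) :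
    κ (if σ.toPerm x ∈ s(a, τ.toPerm a) then z else σ.toPerm x) =
      κ (if x ∈ s(a, τ.toPerm a) then z else x) := by
  have key : ∀ x, x ∉ s(a, τ.toPerm a) → σ.toPerm x ∈ s(a, τ.toPerm a) → κ x = κ z := by
    intro x hx hσx
    have hz' : κ (σ.toPerm a) = κ z := by
      refine hz.resolve_left fun h => hx ?_
      rcases Sym2.mem_iff.1 hσx with h' | h'
      · rw [Sym2.mem_iff, ← h, ← h', σ.invol]; exact Or.inr rfl
      · rw [← h, ← σ.invol x, h', ← h, σ.invol]; simp
    rw [← hz']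
    rcases Sym2.mem_iff.1 hσx with h' | h'
    · rw [← h', σ.invol]
    · rw [← hσ x, removeFun, if_neg hx, if_pos hσx, h', τ.invol]
  by_cases hx : x ∈ s(a, τ.toPerm a) <;> by_cases hσx : σ.toPerm x ∈ s(a, τ.toPerm a)
  · rw [if_pos hx, if_pos hσx]
  · rw [if_pos hx, if_neg hσx]
    exact key _ hσx (by rwa [σ.invol])
  · rw [if_neg hx, if_pos hσx, key x hx hσx]
  · rw [if_neg hx, if_neg hσx]
    have := hσ x
    rwa [removeFun, if_neg hx, if_neg hσx] at this

/-- The permutations of the pairings in `P` after the removal of an edge. -/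
def removedPerms (P : Set (Pairing S)) (he : ∃ x ∈ S, s(x, τ.toPerm x) = s(a, τ.toPerm a)) :
    Set (Equiv.Perm α) :=
  (fun σ : Pairing S => (σ.remove τ he).toPerm) '' P

variable {P : Set (Pairing S)} (he : ∃ x ∈ S, s(x, τ.toPerm x) = s(a, τ.toPerm a))

theorem orb_removeFun {σ : Pairing S} (hσ : σ ∈ P) (x : α) :
    orb (removedPerms P he) (removeFun σ τ s(a, τ.toPerm a) x) = orb (removedPerms P he) x :=
  orb_apply (s := removedPerms P he) ⟨σ, hσ, rfl⟩ x

theorem orb_eq_of_removed (hb : orb (toPerm '' P) (τ.toPerm a) = orb (toPerm '' P) a) {x y : α}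
    (h : orb (removedPerms P he) x = orb (removedPerms P he) y) :
    orb (toPerm '' P) x = orb (toPerm '' P) y := by
  refine eq_of_orb_eq (s := removedPerms P he) (κ := orb (toPerm '' P)) ?_ h
  rintro _ ⟨σ, hσ, rfl⟩ x
  exact removeFun_invariant (fun x => orb_apply (Set.mem_image_of_mem _ hσ) x) hb x

open Classical in
/-- The number of orbits after the removal of an edge whose sides `a` and `b` lie in one orbit. -/
theorem ncard_orbitsOn_remove (ha : a ∈ S) {c c' : α}
    (hcS : c ∈ S.filter (· ∉ s(a, τ.toPerm a))) (hcS' : c' ∈ S.filter (· ∉ s(a, τ.toPerm a)))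
    (hb : orb (toPerm '' P) (τ.toPerm a) = orb (toPerm '' P) a)
    (hc : orb (toPerm '' P) c = orb (toPerm '' P) a)
    (hc' : orb (toPerm '' P) c' = orb (toPerm '' P) a)
    (hP : ∀ σ ∈ P, σ.toPerm a = τ.toPerm a ∨
      orb (removedPerms P he) (σ.toPerm a) = orb (removedPerms P he) c ∨
      orb (removedPerms P he) (σ.toPerm a) = orb (removedPerms P he) c') :
    (orbitsOn (removedPerms P he) (S.filter (· ∉ s(a, τ.toPerm a)))).ncard =
      (orbitsOn (toPerm '' P) S).ncard +
        if orb (removedPerms P he) c = orb (removedPerms P he) c' then 0 else 1 := by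
  -- No old orbit is lost by discarding the edge: the orbit of `a` is still represented by `c`.
  have hSS : orbitsOn (toPerm '' P) S =
      orbitsOn (toPerm '' P) (S.filter (· ∉ s(a, τ.toPerm a))) := by
    refine Set.Subset.antisymm ?_ (Set.image_mono (Finset.coe_subset.2 (Finset.filter_subset _ _)))
    rintro _ ⟨x, hx, rfl⟩
    by_cases hxe : x ∈ s(a, τ.toPerm a)
    · refine ⟨c, hcS, ?_⟩
      change orb _ _ = orb _ _
      rw [hc]
      rcases Sym2.mem_iff.1 hxe with rfl | rfl
      · rfl
      · exact hb.symm
    · exact ⟨x, Finset.mem_coe.2 (Finset.mem_filter.2 ⟨hx, hxe⟩), rfl⟩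
  rw [hSS]
  refine ncard_image_of_merge (Finset.finite_toSet _) hcS hcS' fun x hx y hy => ⟨?_, ?_⟩
  · intro h
    have hxe : x ∉ s(a, τ.toPerm a) := (Finset.mem_filter.1 hx).2
    have hye : y ∉ s(a, τ.toPerm a) := (Finset.mem_filter.1 hy).2
    -- The new orbits, with that of `c'` merged into that of `c`. Once `a` and its partner are sent
    -- to the class of `c`, this is invariant under the old group.
    let κ : α → Set α := fun x => if orb (removedPerms P he) x = orb (removedPerms P he) c' then
        orb (removedPerms P he) c else orb (removedPerms P he) x
    have := eq_of_orb_eq (s := toPerm '' P)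
      (κ := fun x => κ (if x ∈ s(a, τ.toPerm a) then c else x)) ?_ h
    · simp only [if_neg hxe, if_neg hye] at this
      exact this
    · rintro _ ⟨σ, hσ, rfl⟩ x
      refine invariant_of_removeFun (κ := κ) (fun x => ?_) ?_ x
      · simp only [κ, orb_removeFun he hσ]
      · rcases hP σ hσ with h | h | h
        · exact Or.inl h
        · right; simp only [κ, h]
        · right; simp only [κ, h]; simp
  · intro h
    change (if orb (removedPerms P he) x = orb (removedPerms P he) c' then
        orb (removedPerms P he) c else orb (removedPerms P he) x) =
      (if orb (removedPerms P he) y = orb (removedPerms P he) c' then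
        orb (removedPerms P he) c else orb (removedPerms P he) y) at h
    have key : ∀ x, orb (toPerm '' P) x = orb (toPerm '' P) (if
        orb (removedPerms P he) x = orb (removedPerms P he) c' then c else x) := by
      intro x
      split_ifs with hx
      · rw [orb_eq_of_removed he hb hx, hc', hc]
      · rfl
    change orb _ _ = orb _ _
    rw [key x, key y]
    apply orb_eq_of_removed he hb
    split_ifs at h ⊢ <;> exact h

/-- The edge is a block of every pairing in `P`, hence an orbit by itself; it disappears and the
other orbits are untouched. -/
theorem ncard_orbitsOn_remove_isolated (ha : a ∈ S) (hne : P.Nonempty)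
    (hP : ∀ σ ∈ P, σ.toPerm a = τ.toPerm a) :
    (orbitsOn (removedPerms P he) (S.filter (· ∉ s(a, τ.toPerm a)))).ncard + 1 =
      (orbitsOn (toPerm '' P) S).ncard := by
  classical
  have hb : orb (toPerm '' P) (τ.toPerm a) = orb (toPerm '' P) a := by
    obtain ⟨σ, hσ⟩ := hne
    rw [← hP σ hσ]
    exact orb_apply (Set.mem_image_of_mem _ hσ) a
  have hsplit : orbitsOn (toPerm '' P) S =
      insert (orb (toPerm '' P) a)
        (orbitsOn (toPerm '' P) (S.filter (· ∉ s(a, τ.toPerm a)))) := by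
    ext T
    constructor
    · rintro ⟨x, hx, rfl⟩
      by_cases hxe : x ∈ s(a, τ.toPerm a)
      · left
        rcases Sym2.mem_iff.1 hxe with rfl | rfl
        · rfl
        · exact hb
      · exact Or.inr ⟨x, Finset.mem_coe.2 (Finset.mem_filter.2 ⟨hx, hxe⟩), rfl⟩
    · rintro (rfl | ⟨x, hx, rfl⟩)
      · exact ⟨a, ha, rfl⟩
      · exact ⟨x, (Finset.mem_filter.1 hx).1, rfl⟩
  have hnot : orb (toPerm '' P) a ∉
      orbitsOn (toPerm '' P) (S.filter (· ∉ s(a, τ.toPerm a))) := by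
    rintro ⟨x, hx, hxa⟩
    have hx' : x ∉ s(a, τ.toPerm a) := (Finset.mem_filter.1 hx).2
    have := eq_of_orb_eq (s := toPerm '' P) (κ := fun x => decide (x ∈ s(a, τ.toPerm a))) ?_ hxa
    · simp at this
      simp [this] at hx'
    · rintro _ ⟨σ, hσ, rfl⟩ x
      have h1 := hP σ hσ
      have h2 := σ.invol
      have h3 := h2 a
      have h4 := h2 x
      simp only [decide_eq_decide, Sym2.mem_iff]
      grind
  rw [hsplit, Set.ncard_insert_of_notMem hnot ((Finset.finite_toSet _).image _)]
  congr 1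
  refine ncard_image_eq_of_iff fun x hx y hy => ⟨orb_eq_of_removed he hb, fun h => ?_⟩
  have hxe : x ∉ s(a, τ.toPerm a) := (Finset.mem_filter.1 hx).2
  have hye : y ∉ s(a, τ.toPerm a) := (Finset.mem_filter.1 hy).2
  have := eq_of_orb_eq (s := toPerm '' P) (κ := fun x =>
      orb (removedPerms P he) (if x ∈ s(a, τ.toPerm a) then a else x)) ?_ h
  · simpa only [if_neg hxe, if_neg hye] using this
  · rintro _ ⟨σ, hσ, rfl⟩ x
    exact invariant_of_removeFun (fun x => orb_removeFun he hσ x) (Or.inl (hP σ hσ)) x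

end Removal

end Pairing

/-! ### Walking along the boundary of a face -/

namespace Pairing

section Corners
variable {α : Type*} {S : Finset α} (B W : Pairing S)

/-- The dihedral relation: conjugation by `B` inverts the product of the two involutions. -/
theorem apply_zpow_mul (i : ℤ) (x : α) :
    B.toPerm (((W.toPerm * B.toPerm) ^ i) x) =
      ((W.toPerm * B.toPerm) ^ (-i)) (B.toPerm x) := by
  have hB : B.toPerm⁻¹ = B.toPerm := by
    ext x
    rw [Equiv.Perm.inv_eq_iff_eq, B.invol]
  have hW : W.toPerm⁻¹ = W.toPerm := by
    ext x
    rw [Equiv.Perm.inv_eq_iff_eq, W.invol]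
  have h : B.toPerm * (W.toPerm * B.toPerm) * B.toPerm⁻¹ = (W.toPerm * B.toPerm)⁻¹ := by
    rw [mul_inv_rev, hW]
    conv_rhs => rw [hB]
    simp [mul_assoc]
  rw [zpow_neg, ← inv_zpow, ← h, conj_zpow]
  simp

/-- With ρ = W B, suppose B x = ρ^i x. Halving i gives a fixed point: `B` fixes ρ^k x if i = 2k, and
`W` fixes ρ^(k+1) x if i = 2k + 1. Neither involution has fixed points in `S`. -/
theorem not_sameCycle_apply {x : α} (hx : x ∈ S) :
    ¬ (W.toPerm * B.toPerm).SameCycle x (B.toPerm x) := by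
  rintro ⟨i, hi⟩
  have hfix : ∀ (σ : Pairing S) (k : ℤ),
      σ.toPerm (((W.toPerm * B.toPerm) ^ k) x) ≠ ((W.toPerm * B.toPerm) ^ k) x := by
    intro σ k
    rw [σ.ne_iff]
    have hmem : ∀ y, (W.toPerm * B.toPerm) y ∈ S ↔ y ∈ S := fun y => by
      rw [Equiv.Perm.mul_apply, mem_apply_iff, mem_apply_iff]
    have horb : ((W.toPerm * B.toPerm) ^ k) x ∈ orb {W.toPerm * B.toPerm} x :=
      ⟨⟨(W.toPerm * B.toPerm) ^ k,
        Subgroup.zpow_mem _ (Subgroup.subset_closure (Set.mem_singleton _)) k⟩, rfl⟩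
    have := eq_of_mem_orb (κ := (· ∈ S)) (fun f hf y => by
      rw [Set.mem_singleton_iff.1 hf]
      exact propext (hmem y)) horb
    exact this ▸ hx
  obtain ⟨k, rfl | rfl⟩ := Int.even_or_odd' i
  · apply hfix B k
    rw [apply_zpow_mul, ← hi, ← Equiv.Perm.mul_apply, ← zpow_add]
    congr 2
    ring
  · have h : B.toPerm (((W.toPerm * B.toPerm) ^ k) x) =
        ((W.toPerm * B.toPerm) ^ (k + 1)) x := by
      rw [apply_zpow_mul, ← hi, ← Equiv.Perm.mul_apply, ← zpow_add]
      congr 2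
      ring
    apply hfix W (k + 1)
    conv_rhs => rw [add_comm k 1, zpow_add, zpow_one, Equiv.Perm.mul_apply, Equiv.Perm.mul_apply, h]

/-- Both `B` and `W` exchange the two alternatives, so their disjunction is constant on the face. -/
theorem sameCycle_or_of_mem_orb {x y : α} (h : y ∈ orb {B.toPerm, W.toPerm} x) :
    (W.toPerm * B.toPerm).SameCycle x y ∨ (W.toPerm * B.toPerm).SameCycle x (B.toPerm y) := by
  have := eq_of_mem_orb (s := {B.toPerm, W.toPerm}) (κ := fun y =>
    (W.toPerm * B.toPerm).SameCycle x y ∨ (W.toPerm * B.toPerm).SameCycle x (B.toPerm y)) ?_ h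
  · rw [this]
    exact Or.inl (Equiv.Perm.SameCycle.refl _ _)
  · rintro f (rfl | rfl) y
    · simp only [B.invol, or_comm]
    · have h1 : (W.toPerm * B.toPerm) (B.toPerm y) = W.toPerm y := by
        rw [Equiv.Perm.mul_apply, B.invol]
      have h2 : (W.toPerm * B.toPerm) (B.toPerm (W.toPerm y)) = y := by
        rw [Equiv.Perm.mul_apply, B.invol, W.invol]
      have e1 : (W.toPerm * B.toPerm).SameCycle x (W.toPerm y) ↔
          (W.toPerm * B.toPerm).SameCycle x (B.toPerm y) := by
        rw [← h1, Equiv.Perm.sameCycle_apply_right]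
      have e2 : (W.toPerm * B.toPerm).SameCycle x (B.toPerm (W.toPerm y)) ↔
          (W.toPerm * B.toPerm).SameCycle x y := by
        conv_rhs => rw [← h2, Equiv.Perm.sameCycle_apply_right]
      rw [e1, e2, or_comm]

end Corners

section Surgery
variable {α : Type*} [DecidableEq α] [Finite α] {S : Finset α} (B W τ : Pairing S) {a : α}
  (he : ∃ x ∈ S, s(x, τ.toPerm x) = s(a, τ.toPerm a))
include he

/-- Walk a, B a, ρ a, B ρ a, … up to the first arrival at b = τ a. The interior of this walk avoids
the edge, so the removal leaves it connected. Its last step, a `W`-step into b, is rerouted to W a,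
which joins B a to W a. -/
theorem orb_remove_eq_of_sameCycle (ha : a ∈ S)
    (h : (W.toPerm * B.toPerm).SameCycle a (τ.toPerm a)) :
    orb (removedPerms {B, W} he) (B.toPerm a) = orb (removedPerms {B, W} he) (W.toPerm a) := by
  classical
  set ρ := W.toPerm * B.toPerm with hρ
  have hex : ∃ j : ℕ, (ρ ^ j) a = τ.toPerm a := by
    obtain ⟨j, -, hj⟩ := h.exists_pow_eq'
    exact ⟨j, hj⟩
  set j := Nat.find hex with hj
  have hjs : (ρ ^ j) a = τ.toPerm a := Nat.find_spec hex
  have hmin : ∀ i < j, (ρ ^ i) a ≠ τ.toPerm a := fun i hi => Nat.find_min hex hi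
  have hne : τ.toPerm a ≠ a := (τ.ne_iff a).2 ha
  have hbS : τ.toPerm a ∈ S := (τ.mem_apply_iff a).2 ha
  have hret : ∀ i, 0 < i → i ≤ j → (ρ ^ i) a ≠ a := by
    intro i hi hij hia
    apply hmin (j - i) (by omega)
    rw [← hjs]
    conv_rhs => rw [← Nat.sub_add_cancel hij, pow_add, Equiv.Perm.mul_apply, hia]
  -- Elements at odd positions lie in the opposite cycle to that of a and b.
  have hodd : ∀ i : ℕ, B.toPerm ((ρ ^ i) a) ∉ s(a, τ.toPerm a) := by
    intro i hi
    rcases Sym2.mem_iff.1 hi with hi | hi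
    · refine not_sameCycle_apply B W ha ⟨i, ?_⟩
      rw [← hi, B.invol, hi, zpow_natCast]
    · refine not_sameCycle_apply B W hbS (h.symm.trans ⟨i, ?_⟩)
      rw [← hi, B.invol, zpow_natCast]
  have hstep : ∀ i : ℕ, W.toPerm (B.toPerm ((ρ ^ i) a)) = (ρ ^ (i + 1)) a := fun i => by
    rw [pow_succ', Equiv.Perm.mul_apply, hρ, Equiv.Perm.mul_apply]
  have key : ∀ i < j, orb (removedPerms {B, W} he) (B.toPerm ((ρ ^ i) a)) =
      orb (removedPerms {B, W} he) (B.toPerm a) := by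
    intro i
    induction i with
    | zero => exact fun _ => rfl
    | succ i ih =>
      intro hi
      have hn : (ρ ^ (i + 1)) a ∉ s(a, τ.toPerm a) := by
        rw [Sym2.mem_iff, not_or]
        exact ⟨hret _ (by omega) hi.le, hmin _ hi⟩
      rw [← ih (by omega), ← orb_removeFun he (σ := W) (by simp) (B.toPerm ((ρ ^ i) a)),
        removeFun, if_neg (hodd i), hstep, if_neg hn,
        ← orb_removeFun he (σ := B) (by simp) ((ρ ^ (i + 1)) a), removeFun, if_neg hn,
        if_neg (hodd _)]
  have hj0 : 0 < j := by
    rcases Nat.eq_zero_or_pos j with h0 | h0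
    · rw [h0] at hjs
      exact absurd hjs.symm hne
    · exact h0
  rw [← key (j - 1) (by omega), ← orb_removeFun he (σ := W) (by simp), removeFun,
    if_neg (hodd _), hstep, Nat.sub_add_cancel hj0, hjs, if_pos (by simp), τ.invol]

/-- Here b = τ a occurs at an odd position, so the stretch of boundary strictly between a and b has
ends B a and B b. The removal makes them `B`-partners, so the stretch closes up into a face of its
own, which misses W a. -/
theorem orb_remove_ne_of_not_sameCycle (ha : a ∈ S) (hB : B.toPerm a ≠ τ.toPerm a)
    (hface : τ.toPerm a ∈ orb {B.toPerm, W.toPerm} a)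
    (h : ¬ (W.toPerm * B.toPerm).SameCycle a (τ.toPerm a)) :
    orb (removedPerms {B, W} he) (B.toPerm a) ≠ orb (removedPerms {B, W} he) (W.toPerm a) := by
  classical
  have hcyc := (sameCycle_or_of_mem_orb B W hface).resolve_left h
  set ρ := W.toPerm * B.toPerm with hρ
  have hex : ∃ j : ℕ, B.toPerm ((ρ ^ j) a) = τ.toPerm a := by
    obtain ⟨j, -, hj⟩ := hcyc.exists_pow_eq'
    exact ⟨j, by rw [hj, B.invol]⟩
  set j := Nat.find hex with hj
  have hjs : B.toPerm ((ρ ^ j) a) = τ.toPerm a := Nat.find_spec hex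
  have hmin : ∀ i < j, B.toPerm ((ρ ^ i) a) ≠ τ.toPerm a := fun i hi => Nat.find_min hex hi
  have hj0 : 0 < j := by
    rcases Nat.eq_zero_or_pos j with h0 | h0
    · rw [h0] at hjs
      exact absurd hjs hB
    · exact h0
  have hstep : ∀ i : ℕ, W.toPerm (B.toPerm ((ρ ^ i) a)) = (ρ ^ (i + 1)) a := fun i => by
    rw [pow_succ', Equiv.Perm.mul_apply, hρ, Equiv.Perm.mul_apply]
  -- The stretch from B a to ρ^j a = B b; it is nonempty because `hB` forces j > 0.
  let T : Set α := {y | (∃ i, 0 < i ∧ i ≤ j ∧ y = (ρ ^ i) a) ∨ ∃ i < j, y = B.toPerm ((ρ ^ i) a)}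
  have hBa : B.toPerm a ∈ T := Or.inr ⟨0, hj0, rfl⟩
  have hBb : B.toPerm (τ.toPerm a) ∈ T := Or.inl ⟨j, hj0, le_rfl, by rw [← hjs, B.invol]⟩
  have haT : a ∉ T := by
    rintro (⟨i, hi, hij, hia⟩ | ⟨i, hi, hia⟩)
    · apply hmin (j - i) (by omega)
      rw [← hjs]
      conv_rhs => rw [← Nat.sub_add_cancel hij, pow_add, Equiv.Perm.mul_apply, ← hia]
    · refine not_sameCycle_apply B W ha ⟨i, ?_⟩
      conv_rhs => rw [hia, B.invol]
      rw [zpow_natCast]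
  have hbT : τ.toPerm a ∉ T := by
    rintro (⟨i, hi, hij, hia⟩ | ⟨i, hi, hia⟩)
    · exact h ⟨i, by rw [zpow_natCast, hia]⟩
    · exact hmin i hi hia.symm
  have heT : ∀ y ∈ s(a, τ.toPerm a), y ∉ T := by
    intro y hy
    rcases Sym2.mem_iff.1 hy with rfl | rfl
    · exact haT
    · exact hbT
  have hWT : ∀ y ∈ T, W.toPerm y ∈ T := by
    rintro y (⟨i, hi, hij, rfl⟩ | ⟨i, hi, rfl⟩)
    · refine Or.inr ⟨i - 1, by omega, ?_⟩
      rw [← W.invol (B.toPerm _), hstep, Nat.sub_add_cancel hi]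
    · exact Or.inl ⟨i + 1, by omega, hi, hstep i⟩
  have hBT : ∀ y ∈ T, B.toPerm y ∉ s(a, τ.toPerm a) → B.toPerm y ∈ T := by
    rintro y (⟨i, hi, hij, rfl⟩ | ⟨i, hi, rfl⟩) hy
    · rcases hij.lt_or_eq with hij | rfl
      · exact Or.inr ⟨i, hij, rfl⟩
      · exact absurd (by rw [hjs]; simp) hy
    · rw [B.invol] at hy ⊢
      rcases Nat.eq_zero_or_pos i with rfl | h0
      · exact absurd (by simp) hy
      · exact Or.inl ⟨i, h0, hi.le, rfl⟩
  have hclosed : ∀ σ ∈ ({B, W} : Set (Pairing S)), ∀ y ∈ T,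
      removeFun σ τ s(a, τ.toPerm a) y ∈ T := by
    rintro σ (rfl | rfl) y hy
    · rw [removeFun, if_neg fun hye => heT y hye hy]
      split_ifs with h2
      · rcases Sym2.mem_iff.1 h2 with h2 | h2
        · rwa [h2]
        · rwa [h2, τ.invol]
      · exact hBT y hy h2
    · rw [removeFun, if_neg fun hye => heT y hye hy,
        if_neg fun hye => heT _ hye (hWT y hy)]
      exact hWT y hy
  intro heq
  have := eq_of_orb_eq (κ := (· ∈ T)) ?_ heq
  · have hWa : W.toPerm a ∈ T := this ▸ hBa
    exact haT (by simpa [W.invol] using hWT _ hWa)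
  · rintro _ ⟨σ, hσ, rfl⟩ y
    refine propext ⟨fun hy => ?_, fun hy => hclosed σ hσ y hy⟩
    rw [← (σ.remove τ he).invol y]
    exact hclosed σ hσ _ hy

end Surgery

end Pairing

/-! ### Removal of an edge from a map -/

namespace NonorientedMap

section Orbits
variable {α : Type*} (M : NonorientedMap α) {a : α}

theorem faces_eq : M.faces = orbitsOn (Pairing.toPerm '' {M.black, M.white}) M.base := by
  rw [Set.image_pair]; rfl

theorem components_eq :
    M.components = orbitsOn (Pairing.toPerm '' {M.black, M.white, M.edge}) M.base := by
  rw [Set.image_insert_eq, Set.image_pair]; rfl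

theorem blackVertices_eq :
    M.blackVertices = orbitsOn (Pairing.toPerm '' {M.black, M.edge}) M.base := by
  rw [Set.image_pair]; rfl

theorem whiteVertices_eq :
    M.whiteVertices = orbitsOn (Pairing.toPerm '' {M.white, M.edge}) M.base := by
  rw [Set.image_pair]; rfl

variable {M}

theorem not_isInterface_iff :
    ¬ M.IsInterface s(a, M.edge.toPerm a) ↔
      M.edge.toPerm a ∈ orb {M.black.toPerm, M.white.toPerm} a := by
  simp only [IsInterface, Sym2.mem_iff, exists_eq_or_imp, exists_eq_left, M.edge.invol, not_or,
    not_not]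
  rw [MulAction.mem_orbit_symm]
  exact and_self_iff

theorem isTwisted_iff :
    M.IsTwisted s(a, M.edge.toPerm a) ↔
      (M.white.toPerm * M.black.toPerm).SameCycle a (M.edge.toPerm a) := by
  simp only [IsTwisted, Sym2.mem_iff, exists_eq_or_imp, exists_eq_left, M.edge.invol]
  rw [Equiv.Perm.sameCycle_comm]
  exact or_self_iff

end Orbits

section Removal
variable {α : Type*} [DecidableEq α] (M : NonorientedMap α) {a : α}

theorem remove_eq {e : Sym2 α} (h : e ∈ M.edges) :
    M.remove e =
      { base := M.base.filter (fun x => x ∉ e)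
        black := M.black.remove M.edge (Finset.mem_image.1 h)
        white := M.white.remove M.edge (Finset.mem_image.1 h)
        edge := M.edge.remove M.edge (Finset.mem_image.1 h) } := dif_pos h

variable {M} (ha : s(a, M.edge.toPerm a) ∈ M.edges)

theorem faces_remove : (M.remove s(a, M.edge.toPerm a)).faces =
    orbitsOn (Pairing.removedPerms {M.black, M.white} (Finset.mem_image.1 ha))
      (M.base.filter (· ∉ s(a, M.edge.toPerm a))) := by
  rw [remove_eq M ha, Pairing.removedPerms, Set.image_pair]; rfl

theorem components_remove : (M.remove s(a, M.edge.toPerm a)).components =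
    orbitsOn (Pairing.removedPerms {M.black, M.white, M.edge} (Finset.mem_image.1 ha))
      (M.base.filter (· ∉ s(a, M.edge.toPerm a))) := by
  rw [remove_eq M ha, Pairing.removedPerms, Set.image_insert_eq, Set.image_pair]; rfl

theorem blackVertices_remove : (M.remove s(a, M.edge.toPerm a)).blackVertices =
    orbitsOn (Pairing.removedPerms {M.black, M.edge} (Finset.mem_image.1 ha))
      (M.base.filter (· ∉ s(a, M.edge.toPerm a))) := by
  rw [remove_eq M ha, Pairing.removedPerms, Set.image_pair]; rfl

theorem whiteVertices_remove : (M.remove s(a, M.edge.toPerm a)).whiteVertices =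
    orbitsOn (Pairing.removedPerms {M.white, M.edge} (Finset.mem_image.1 ha))
      (M.base.filter (· ∉ s(a, M.edge.toPerm a))) := by
  rw [remove_eq M ha, Pairing.removedPerms, Set.image_pair]; rfl

theorem mem_edges_iff {x : α} : s(x, M.edge.toPerm x) ∈ M.edges ↔ x ∈ M.base := by
  refine ⟨fun h => ?_, fun h => Finset.mem_image_of_mem _ h⟩
  obtain ⟨y, hy, hxy⟩ := Finset.mem_image.1 h
  rcases Sym2.mem_iff.1 (hxy ▸ Sym2.mem_mk_left x _ : x ∈ s(y, M.edge.toPerm y)) with rfl | rfl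
  · exact hy
  · exact (M.edge.mem_apply_iff _).2 hy

theorem edges_remove {e : Sym2 α} (he : e ∈ M.edges) : (M.remove e).edges = M.edges.erase e := by
  rw [remove_eq M he]
  have hinv := M.edge.invol
  obtain ⟨a, ha, rfl⟩ := Finset.mem_image.1 he
  have hE : ∀ x, x ∉ s(a, M.edge.toPerm a) →
      Pairing.removeFun M.edge M.edge s(a, M.edge.toPerm a) x = M.edge.toPerm x ∧
        s(x, M.edge.toPerm x) ≠ s(a, M.edge.toPerm a) := by
    intro x hx
    have hx' : M.edge.toPerm x ∉ s(a, M.edge.toPerm a) := by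
      have := hinv x
      have := hinv a
      rw [Sym2.mem_iff] at hx ⊢
      grind
    refine ⟨by rw [Pairing.removeFun, if_neg hx, if_neg hx'], fun h => hx ?_⟩
    rw [← h]
    simp
  ext e
  simp only [edges, Finset.mem_image, Finset.mem_erase, Finset.mem_filter]
  constructor
  · rintro ⟨x, ⟨hx, hxe⟩, rfl⟩
    change s(x, Pairing.removeFun M.edge M.edge _ x) ≠ _ ∧ ∃ _, _ ∧ _ = s(x, Pairing.removeFun M.edge M.edge _ x)
    rw [(hE x hxe).1]
    exact ⟨(hE x hxe).2, x, hx, rfl⟩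
  · rintro ⟨hne, x, hx, rfl⟩
    have hxe : x ∉ s(a, M.edge.toPerm a) := by
      intro h
      apply hne
      rcases Sym2.mem_iff.1 h with rfl | rfl
      · rfl
      · rw [hinv, Sym2.eq_swap]
    refine ⟨x, ⟨hx, hxe⟩, ?_⟩
    change s(x, Pairing.removeFun M.edge M.edge _ x) = _
    rw [(hE x hxe).1]

end Removal

end NonorientedMap

/-! ### Counting vertices, faces and components after a removal -/

namespace Pairing

section Count
variable {α : Type*} [DecidableEq α] {S : Finset α} (B W τ : Pairing S) {a : α}
  (he : ∃ x ∈ S, s(x, τ.toPerm x) = s(a, τ.toPerm a))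

theorem apply_mem_filter (ha : a ∈ S) (h : B.toPerm a ≠ τ.toPerm a) :
    B.toPerm a ∈ S.filter (· ∉ s(a, τ.toPerm a)) := by
  rw [Finset.mem_filter, Sym2.mem_iff, not_or]
  exact ⟨(B.mem_apply_iff a).2 ha, (B.ne_iff a).2 ha, h⟩

/-- The number of vertices of one colour after the removal of an edge. -/
theorem ncard_vertices_remove (ha : a ∈ S) :
    (orbitsOn (removedPerms {B, τ} he) (S.filter (· ∉ s(a, τ.toPerm a)))).ncard +
      (if B.toPerm a = τ.toPerm a then 1 else 0) = (orbitsOn (toPerm '' {B, τ}) S).ncard := by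
  classical
  split_ifs with h
  · exact ncard_orbitsOn_remove_isolated he ha ⟨B, by simp⟩ (by rintro σ (rfl | rfl); exacts [h, rfl])
  · have horb : ∀ σ ∈ ({B, τ} : Set (Pairing S)),
        orb (toPerm '' {B, τ}) (σ.toPerm a) = orb (toPerm '' {B, τ}) a :=
      fun σ hσ => orb_apply (Set.mem_image_of_mem _ hσ) a
    rw [ncard_orbitsOn_remove he ha (apply_mem_filter B τ ha h) (apply_mem_filter B τ ha h)
      (horb τ (by simp)) (horb B (by simp)) (horb B (by simp)), if_pos rfl]
    · simp
    · rintro σ (rfl | rfl)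
      · exact Or.inr (Or.inl rfl)
      · exact Or.inl rfl

open Classical in
/-- The number of faces or components after the removal of an edge with both sides on the same
face or component. -/
theorem ncard_orbitsOn_remove_two {P : Set (Pairing S)} (ha : a ∈ S) (hB : B ∈ P) (hW : W ∈ P)
    (hP : ∀ σ ∈ P, σ = B ∨ σ = W ∨ σ = τ)
    (hb : orb (toPerm '' P) (τ.toPerm a) = orb (toPerm '' P) a) :
    (orbitsOn (removedPerms P he) (S.filter (· ∉ s(a, τ.toPerm a)))).ncard +
      (if B.toPerm a = τ.toPerm a then 1 else 0) + (if W.toPerm a = τ.toPerm a then 1 else 0) +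
      (if B.toPerm a ≠ τ.toPerm a ∧ W.toPerm a ≠ τ.toPerm a ∧
        orb (removedPerms P he) (B.toPerm a) = orb (removedPerms P he) (W.toPerm a) then 1 else 0) =
      (orbitsOn (toPerm '' P) S).ncard + 1 := by
  have horb : ∀ σ ∈ P, orb (toPerm '' P) (σ.toPerm a) = orb (toPerm '' P) a :=
    fun σ hσ => orb_apply (Set.mem_image_of_mem _ hσ) a
  -- If the edge is a block of both `B` and `W`, its orbit vanishes; if of exactly one, the count is
  -- unchanged; if of neither, the orbit survives or splits in two.
  by_cases h1 : B.toPerm a = τ.toPerm a <;> by_cases h2 : W.toPerm a = τ.toPerm a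
  · have := ncard_orbitsOn_remove_isolated he ha ⟨B, hB⟩ (fun σ hσ => by
      rcases hP σ hσ with rfl | rfl | rfl
      exacts [h1, h2, rfl])
    simp [h1, h2, ← this]
  · rw [ncard_orbitsOn_remove he ha (apply_mem_filter W τ ha h2) (apply_mem_filter W τ ha h2)
      hb (horb W hW) (horb W hW)]
    · simp [h1, h2]
    · intro σ hσ
      rcases hP σ hσ with rfl | rfl | rfl
      exacts [Or.inl h1, Or.inr (Or.inl rfl), Or.inl rfl]
  · rw [ncard_orbitsOn_remove he ha (apply_mem_filter B τ ha h1) (apply_mem_filter B τ ha h1)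
      hb (horb B hB) (horb B hB)]
    · simp [h1, h2]
    · intro σ hσ
      rcases hP σ hσ with rfl | rfl | rfl
      exacts [Or.inr (Or.inl rfl), Or.inl h2, Or.inl rfl]
  · rw [ncard_orbitsOn_remove he ha (apply_mem_filter B τ ha h1) (apply_mem_filter W τ ha h2)
      hb (horb B hB) (horb W hW)]
    · by_cases h3 : orb (removedPerms P he) (B.toPerm a) = orb (removedPerms P he) (W.toPerm a) <;>
      simp [h1, h2, h3]
    · intro σ hσ
      rcases hP σ hσ with rfl | rfl | rfl
      exacts [Or.inr (Or.inl rfl), Or.inr (Or.inr rfl), Or.inl rfl]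

end Count

end Pairing

namespace NonorientedMap

section Removal
variable {α : Type*} [DecidableEq α]

/-- The first Betti number of the graph drawn by `M`. -/
noncomputable def bettiNumber (M : NonorientedMap α) : ℤ :=
  M.edges.card - M.numVertices + M.components.ncard

variable {M : NonorientedMap α} {a : α}

theorem card_edges_remove {e : Sym2 α} (he : e ∈ M.edges) :
    (M.remove e).edges.card + 1 = M.edges.card := by
  rw [edges_remove he, Finset.card_erase_add_one he]

theorem numVertices_remove (ha : s(a, M.edge.toPerm a) ∈ M.edges) :
    (M.remove s(a, M.edge.toPerm a)).numVertices +
      (if M.black.toPerm a = M.edge.toPerm a then 1 else 0) +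
      (if M.white.toPerm a = M.edge.toPerm a then 1 else 0) = M.numVertices := by
  have h1 := Pairing.ncard_vertices_remove M.black M.edge (Finset.mem_image.1 ha)
    (mem_edges_iff.1 ha)
  have h2 := Pairing.ncard_vertices_remove M.white M.edge (Finset.mem_image.1 ha)
    (mem_edges_iff.1 ha)
  rw [← blackVertices_remove ha, ← blackVertices_eq] at h1
  rw [← whiteVertices_remove ha, ← whiteVertices_eq] at h2
  unfold numVertices
  omega

open Classical in
theorem components_ncard_remove (ha : s(a, M.edge.toPerm a) ∈ M.edges) :
    (M.remove s(a, M.edge.toPerm a)).components.ncard +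
      (if M.black.toPerm a = M.edge.toPerm a then 1 else 0) +
      (if M.white.toPerm a = M.edge.toPerm a then 1 else 0) +
      (if M.black.toPerm a ≠ M.edge.toPerm a ∧ M.white.toPerm a ≠ M.edge.toPerm a ∧
        orb (Pairing.removedPerms {M.black, M.white, M.edge} (Finset.mem_image.1 ha))
          (M.black.toPerm a) =
        orb (Pairing.removedPerms {M.black, M.white, M.edge} (Finset.mem_image.1 ha))
          (M.white.toPerm a) then 1 else 0) = M.components.ncard + 1 := by
  rw [components_remove ha, components_eq]
  refine Pairing.ncard_orbitsOn_remove_two M.black M.white M.edge (Finset.mem_image.1 ha)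
    (mem_edges_iff.1 ha) (by simp) (by simp) (by simp) ?_
  exact orb_apply (Set.mem_image_of_mem Pairing.toPerm (by simp)) a

open Classical in
theorem faces_ncard_remove (ha : s(a, M.edge.toPerm a) ∈ M.edges)
    (hi : ¬ M.IsInterface s(a, M.edge.toPerm a)) :
    (M.remove s(a, M.edge.toPerm a)).faces.ncard +
      (if M.black.toPerm a = M.edge.toPerm a then 1 else 0) +
      (if M.white.toPerm a = M.edge.toPerm a then 1 else 0) +
      (if M.black.toPerm a ≠ M.edge.toPerm a ∧ M.white.toPerm a ≠ M.edge.toPerm a ∧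
        orb (Pairing.removedPerms {M.black, M.white} (Finset.mem_image.1 ha))
          (M.black.toPerm a) =
        orb (Pairing.removedPerms {M.black, M.white} (Finset.mem_image.1 ha))
          (M.white.toPerm a) then 1 else 0) = M.faces.ncard + 1 := by
  rw [faces_remove ha, faces_eq]
  refine Pairing.ncard_orbitsOn_remove_two M.black M.white M.edge (Finset.mem_image.1 ha)
    (mem_edges_iff.1 ha) (by simp) (by simp) (fun σ h => h.imp_right Or.inl) ?_
  rw [Set.image_pair]
  exact MulAction.orbit_eq_iff.2 (not_isInterface_iff.1 hi)

/-- The losses of vertices cancel against the same terms in the count of components. What remains is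
a drop of 1 if B a ≠ τ a, W a ≠ τ a and these two corners stay connected, and of 0 otherwise. -/
theorem bettiNumber_remove_le {e : Sym2 α} (he : e ∈ M.edges) :
    (M.remove e).bettiNumber ≤ M.bettiNumber := by
  classical
  obtain ⟨a, -, rfl⟩ := Finset.mem_image.1 he
  have h1 := card_edges_remove he
  have h2 := numVertices_remove he
  have h3 := components_ncard_remove he
  unfold bettiNumber
  omega

variable [Finite α]

/-- Neither corner pairing has the edge as a block, since that would put its sides in opposite
cycles. The elements B a and W a stay on one face, hence in one component. -/
theorem remove_of_isTwisted {e : Sym2 α} (he : e ∈ M.edges) (ht : M.IsTwisted e)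
    (hi : ¬ M.IsInterface e) :
    (M.remove e).bettiNumber = M.bettiNumber - 1 ∧
      (M.remove e).faces.ncard = M.faces.ncard ∧
      (M.remove e).components.ncard = M.components.ncard := by
  classical
  obtain ⟨a, ha, rfl⟩ := Finset.mem_image.1 he
  rw [isTwisted_iff] at ht
  have hB : M.black.toPerm a ≠ M.edge.toPerm a := fun h =>
    Pairing.not_sameCycle_apply M.black M.white ha (h ▸ ht)
  have hW : M.white.toPerm a ≠ M.edge.toPerm a := fun h => by
    have hρ : M.white.toPerm a = (M.white.toPerm * M.black.toPerm) (M.black.toPerm a) := by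
      rw [Equiv.Perm.mul_apply, M.black.invol]
    rw [← h, hρ, Equiv.Perm.sameCycle_apply_right] at ht
    exact Pairing.not_sameCycle_apply M.black M.white ha ht
  have hF := Pairing.orb_remove_eq_of_sameCycle M.black M.white M.edge (Finset.mem_image.1 he) ha ht
  have hC : orb (Pairing.removedPerms {M.black, M.white, M.edge} (Finset.mem_image.1 he))
      (M.black.toPerm a) =
      orb (Pairing.removedPerms {M.black, M.white, M.edge} (Finset.mem_image.1 he))
          (M.white.toPerm a) := by
    refine eq_of_orb_eq (s := Pairing.removedPerms {M.black, M.white} _) ?_ hF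
    rintro f ⟨σ, hσ, rfl⟩ x
    refine orb_apply (Set.mem_image_of_mem _ ?_) x
    rcases hσ with rfl | rfl <;> simp
  have h1 := card_edges_remove he
  have h2 := numVertices_remove he
  have h3 := components_ncard_remove he
  have h4 := faces_ncard_remove he hi
  rw [if_neg hB, if_neg hW] at h2
  rw [if_neg hB, if_neg hW, if_pos ⟨hB, hW, hC⟩] at h3
  rw [if_neg hB, if_neg hW, if_pos ⟨hB, hW, hF⟩] at h4
  unfold bettiNumber
  omega

/-- The quantity is |E| - |V| + |F|. A straight edge never leaves B a and W a on a common face, so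
the changes of the three terms balance. -/
theorem remove_of_not_isTwisted {e : Sym2 α} (he : e ∈ M.edges) (ht : ¬ M.IsTwisted e)
    (hi : ¬ M.IsInterface e) :
    (M.remove e).bettiNumber + (M.remove e).faces.ncard - (M.remove e).components.ncard =
      M.bettiNumber + M.faces.ncard - M.components.ncard := by
  classical
  obtain ⟨a, ha, rfl⟩ := Finset.mem_image.1 he
  have h1 := card_edges_remove he
  have h2 := numVertices_remove he
  have h4 := faces_ncard_remove he hi
  rw [isTwisted_iff] at ht
  rw [if_neg (fun h : _ ∧ _ ∧ _ => Pairing.orb_remove_ne_of_not_sameCycle M.black M.white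
    M.edge (Finset.mem_image.1 he) ha h.1 (not_isInterface_iff.1 hi) ht h.2.2)] at h4
  unfold bettiNumber
  omega

-- Sending a face to the component containing it is surjective, hence injective when the finite
-- cardinalities agree. The two sides of an edge share a component, so they share a face.
omit [Finite α] in
theorem not_isInterface_of_faces_eq_components (h : M.faces.ncard = M.components.ncard)
    {e : Sym2 α} (he : e ∈ M.edges) : ¬ M.IsInterface e := by
  obtain ⟨a, ha, rfl⟩ := Finset.mem_image.1 he
  rw [not_isInterface_iff]
  set s : Set (Equiv.Perm α) := {M.black.toPerm, M.white.toPerm} with hs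
  set t : Set (Equiv.Perm α) := {M.black.toPerm, M.white.toPerm, M.edge.toPerm} with hts
  have hst : ∀ x, ⋃ y ∈ orb s x, orb t y = orb t x := by
    intro x
    have : ∀ y ∈ orb s x, orb t y = orb t x := fun y hy =>
      eq_of_mem_orb (fun f hf z => orb_apply (by simp only [hs, hts, Set.mem_insert_iff, Set.mem_singleton_iff] at hf ⊢; tauto) z) hy
    refine Set.Subset.antisymm (Set.iUnion₂_subset fun y hy => (this y hy).subset) ?_
    exact Set.subset_biUnion_of_mem (u := fun y => orb t y) (MulAction.mem_orbit_self x)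
  have himg : (fun T : Set α => ⋃ y ∈ T, orb t y) '' M.faces = M.components := by
    change _ '' ((fun x => orb s x) '' _) = (fun x => orb t x) '' _
    rw [Set.image_image]
    exact Set.image_congr fun x _ => hst x
  have hinj : Set.InjOn (fun T : Set α => ⋃ y ∈ T, orb t y) M.faces :=
    Set.injOn_of_ncard_image_eq (by rw [himg, h]) ((Finset.finite_toSet _).image _)
  have hb : M.edge.toPerm a ∈ M.base := (M.edge.mem_apply_iff a).2 ha
  have := hinj (x₁ := orb s (M.edge.toPerm a)) ⟨_, hb, rfl⟩ (x₂ := orb s a) ⟨_, ha, rfl⟩ (by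
    dsimp only
    rw [hst, hst]
    exact orb_apply (by simp [hts]) a)
  exact this ▸ MulAction.mem_orbit_self _

end Removal

end NonorientedMap

/-! ### The leading coefficient of the weight of a history -/

theorem orbitsOn_empty {α : Type*} (s : Set (Equiv.Perm α)) :
    orbitsOn s ∅ = ∅ := by
  simp [orbitsOn]

namespace NonorientedMap

section Histories
variable {α : Type*} [DecidableEq α]

theorem mem_histories_iff {M : NonorientedMap α} {l : List (Sym2 α)} :
    l ∈ M.histories ↔ (l : Multiset (Sym2 α)) = M.edges.val := by
  rw [histories, Multiset.mem_toFinset, Multiset.mem_lists_iff]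
  exact eq_comm

theorem nil_mem_histories_iff {M : NonorientedMap α} :
    [] ∈ M.histories ↔ M.base = ∅ := by
  rw [mem_histories_iff, Multiset.coe_nil, eq_comm, Finset.val_eq_zero, edges,
    Finset.image_eq_empty]

theorem cons_mem_histories {M : NonorientedMap α} {e : Sym2 α} {l : List (Sym2 α)}
    (h : e :: l ∈ M.histories) : e ∈ M.edges ∧ l ∈ (M.remove e).histories := by
  rw [mem_histories_iff, ← Multiset.cons_coe] at h
  have he : e ∈ M.edges := by
    rw [← Finset.mem_val, ← h]
    exact Multiset.mem_cons_self _ _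
  refine ⟨he, ?_⟩
  rw [mem_histories_iff, edges_remove he, Finset.erase_val, ← h, Multiset.erase_cons_head]

theorem card_histories (M : NonorientedMap α) :
    M.histories.card = M.edges.card.factorial := by
  rw [histories, Multiset.toFinset_card_of_nodup (Multiset.lists_nodup_finset _)]
  conv_lhs => rw [← Multiset.coe_toList M.edges.val]
  rw [Multiset.lists_coe, Multiset.coe_card, List.length_permutations, Multiset.length_toList,
    Finset.card_val]

theorem bettiNumber_eq_zero {M : NonorientedMap α} (h : M.base = ∅) : M.bettiNumber = 0 := by
  simp [bettiNumber, numVertices, blackVertices, whiteVertices, components, edges, h,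
    orbitsOn_empty]

/-- Remove all edges: the number never increases and ends at zero. -/
theorem bettiNumber_nonneg (M : NonorientedMap α) : 0 ≤ M.bettiNumber := by
  obtain ⟨l, hl⟩ : ∃ l, l ∈ M.histories := ⟨M.edges.toList, by
    rw [mem_histories_iff, Finset.coe_toList]⟩
  induction l generalizing M with
  | nil => exact (bettiNumber_eq_zero (nil_mem_histories_iff.1 hl)).ge
  | cons e l ih =>
    obtain ⟨he, hl⟩ := cons_mem_histories hl
    exact (ih _ hl).trans (bettiNumber_remove_le he)

variable [Finite α]

theorem coeff_historyWeight_eq_zero {M : NonorientedMap α} {l : List (Sym2 α)}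
    (hl : l ∈ M.histories) {k : ℕ} (hk : M.bettiNumber < k) :
    (M.historyWeight l).coeff k = 0 := by
  classical
  induction l generalizing M k with
  | nil =>
    rw [bettiNumber_eq_zero (nil_mem_histories_iff.1 hl)] at hk
    rw [historyWeight, coeff_one, if_neg (by omega)]
  | cons e l ih =>
    obtain ⟨he, hl⟩ := cons_mem_histories hl
    have hle := bettiNumber_remove_le he
    rw [historyWeight, edgeWeight]
    split_ifs with hi ht
    · rw [coeff_C_mul, ih hl (by omega), mul_zero]
    · have h := (remove_of_isTwisted he ht hi).1
      cases k with
      | zero => exact coeff_X_mul_zero _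
      | succ k => rw [coeff_X_mul, ih hl (by push_cast at hk; omega)]
    · rw [one_mul, ih hl (by omega)]

omit [Finite α] in
theorem IsTopDegreeHistory.faces_eq {M : NonorientedMap α} {l : List (Sym2 α)}
    (h : M.IsTopDegreeHistory l) : M.faces.ncard = M.components.ncard := by
  cases l with
  | nil => exact h
  | cons e l => exact h.1

-- Without interface edges every factor is γ or 1. The coefficient survives as long as b drops only
-- at twisted edges, that is, as long as |F| = |C| is preserved.
open Classical in
theorem coeff_historyWeight_eq {M : NonorientedMap α} {l : List (Sym2 α)}
    (hl : l ∈ M.histories) (hF : M.faces.ncard = M.components.ncard) {k : ℕ}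
    (hk : M.bettiNumber = k) :
    (M.historyWeight l).coeff k = if M.IsTopDegreeHistory l then 1 else 0 := by
  induction l generalizing M k with
  | nil =>
    rw [bettiNumber_eq_zero (nil_mem_histories_iff.1 hl)] at hk
    rw [historyWeight, coeff_one, if_pos (by omega)]
    exact (if_pos hF).symm
  | cons e l ih =>
    obtain ⟨he, hl⟩ := cons_mem_histories hl
    have htop : M.IsTopDegreeHistory (e :: l) ↔ (M.remove e).IsTopDegreeHistory l :=
      and_iff_right hF
    have hi := not_isInterface_of_faces_eq_components hF he
    rw [historyWeight, edgeWeight, if_neg hi, if_congr htop rfl rfl]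
    split_ifs with ht htl htl
    all_goals try rw [one_mul]
    · obtain ⟨h1, h2, h3⟩ := remove_of_isTwisted he ht hi
      have h0 := (M.remove e).bettiNumber_nonneg
      obtain ⟨k, rfl⟩ : ∃ m, k = m + 1 := ⟨k - 1, by omega⟩
      rw [coeff_X_mul, ih hl (by omega) (by push_cast at hk; omega), if_pos htl]
    · obtain ⟨h1, h2, h3⟩ := remove_of_isTwisted he ht hi
      have h0 := (M.remove e).bettiNumber_nonneg
      obtain ⟨k, rfl⟩ : ∃ m, k = m + 1 := ⟨k - 1, by omega⟩
      rw [coeff_X_mul, ih hl (by omega) (by push_cast at hk; omega), if_neg htl]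
    · have h1 := remove_of_not_isTwisted he ht hi
      have h2 := htl.faces_eq
      rw [ih hl h2 (by omega), if_pos htl]
    · have h1 := remove_of_not_isTwisted he ht hi
      have h2 := bettiNumber_remove_le he
      -- The excess of faces over components after the removal equals the drop of b. If it is
      -- nonzero, b is now below k and the degree bound applies.
      by_cases h3 : (M.remove e).faces.ncard = (M.remove e).components.ncard
      · rw [ih hl h3 (by omega), if_neg htl]
      · exact coeff_historyWeight_eq_zero hl (by omega)

theorem coeff_mon_eq_zero {M : NonorientedMap α} {k : ℕ} (hk : M.bettiNumber < k) :
    M.mon.coeff k = 0 := by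
  rw [mon, coeff_C_mul, finsetSum_coeff,
    Finset.sum_eq_zero fun l hl => coeff_historyWeight_eq_zero hl hk, mul_zero]

theorem coeff_mon_eq_monTop {M : NonorientedMap α} (hF : M.faces.ncard = M.components.ncard)
    {k : ℕ} (hk : M.bettiNumber = k) : M.mon.coeff k = M.monTop := by
  classical
  rw [mon, coeff_C_mul, finsetSum_coeff,
    Finset.sum_congr rfl fun l hl => coeff_historyWeight_eq hl hF hk, Finset.sum_boole, monTop,
    card_histories, one_div, inv_mul_eq_div]

end Histories

end NonorientedMap

/-! ### Gluings of a single polygon -/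

section Glued
variable {α : Type*} [DecidableEq α] [Fintype α] {B W : Pairing (Finset.univ : Finset α)}

theorem card_edges_gluedMap (E : Pairing (Finset.univ : Finset α)) :
    Fintype.card α = 2 * (gluedMap B W E).edges.card := by
  have hinv := E.invol
  have := Finset.card_eq_sum_card_image (fun x => s(x, E.toPerm x)) (Finset.univ : Finset α)
  rw [← Finset.card_univ, this, Finset.sum_const_nat (m := 2), mul_comm]
  · rfl
  · intro e he
    obtain ⟨a, -, rfl⟩ := Finset.mem_image.1 he
    have : Finset.univ.filter (fun x => s(x, E.toPerm x) = s(a, E.toPerm a)) =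
        {a, E.toPerm a} := by
      ext x
      have := hinv x
      have := hinv a
      simp only [Finset.mem_filter, Finset.mem_univ, true_and, Sym2.eq_iff, Finset.mem_insert,
        Finset.mem_singleton]
      grind
    rw [this, Finset.card_pair]
    exact ((E.ne_iff a).2 (Finset.mem_univ a)).symm

omit [DecidableEq α] in
theorem components_ncard_gluedMap (hface : (polygons B W).ncard = 1)
    (E : Pairing (Finset.univ : Finset α)) : (gluedMap B W E).components.ncard = 1 := by
  obtain ⟨T, hT⟩ := Set.ncard_eq_one.1 hface
  have hmem : ∀ x, orb {B.toPerm, W.toPerm} x = T := fun x => by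
    rw [← Set.mem_singleton_iff, ← hT]
    exact ⟨x, Finset.mem_coe.2 (Finset.mem_univ x), rfl⟩
  obtain ⟨x, -, hx⟩ : T ∈ polygons B W := hT ▸ rfl
  have horb : ∀ y, orb {B.toPerm, W.toPerm, E.toPerm} y =
      orb {B.toPerm, W.toPerm, E.toPerm} x := fun y =>
    eq_of_orb_eq (s := {B.toPerm, W.toPerm}) (κ := orb {B.toPerm, W.toPerm, E.toPerm})
      (fun f hf z => orb_apply (by
        simp only [Set.mem_insert_iff, Set.mem_singleton_iff] at hf ⊢; tauto) z)
      ((hmem y).trans (hmem x).symm)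
  rw [Set.ncard_eq_one]
  refine ⟨orb {B.toPerm, W.toPerm, E.toPerm} x, ?_⟩
  ext U
  constructor
  · rintro ⟨y, -, rfl⟩
    exact horb y
  · rintro rfl
    exact ⟨x, Finset.mem_coe.2 (Finset.mem_univ x), rfl⟩

theorem bettiNumber_gluedMap {n : ℕ} (hcard : Fintype.card α = 2 * n)
    (hface : (polygons B W).ncard = 1) (E : Pairing (Finset.univ : Finset α)) :
    (gluedMap B W E).bettiNumber = n + 1 - (gluedMap B W E).numVertices := by
  have := card_edges_gluedMap (B := B) (W := W) E
  rw [NonorientedMap.bettiNumber, components_ncard_gluedMap hface]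
  push_cast
  omega

theorem numVertices_gluedMap_le {n : ℕ} (hcard : Fintype.card α = 2 * n)
    (hface : (polygons B W).ncard = 1) (E : Pairing (Finset.univ : Finset α)) :
    (gluedMap B W E).numVertices ≤ n + 1 := by
  have h1 := bettiNumber_gluedMap hcard hface E
  have h2 := (gluedMap B W E).bettiNumber_nonneg
  omega

theorem natDegree_mon_gluedMap_le {n : ℕ} (hcard : Fintype.card α = 2 * n)
    (hface : (polygons B W).ncard = 1) (E : Pairing (Finset.univ : Finset α)) :
    (gluedMap B W E).mon.natDegree ≤ n + 1 - (gluedMap B W E).numVertices := by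
  have h1 := bettiNumber_gluedMap hcard hface E
  rw [natDegree_le_iff_coeff_eq_zero]
  intro k hk
  exact NonorientedMap.coeff_mon_eq_zero (by omega)

theorem coeff_mon_gluedMap {n : ℕ} (hcard : Fintype.card α = 2 * n)
    (hface : (polygons B W).ncard = 1) (E : Pairing (Finset.univ : Finset α)) :
    (gluedMap B W E).mon.coeff (n + 1 - (gluedMap B W E).numVertices) =
      (gluedMap B W E).monTop := by
  have h1 := bettiNumber_gluedMap hcard hface E
  have h2 := numVertices_gluedMap_le hcard hface E
  exact NonorientedMap.coeff_mon_eq_monTop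
    ((components_ncard_gluedMap hface E).symm ▸ hface) (by omega)

end Glued

/-! ### Embeddings into multirectangular diagrams -/

/-- The indices of the rectangles to which the successive rows of a multirectangular diagram
belong. -/
def multirectBlocks {l : ℕ} (p : Fin l → ℕ) : List (Fin l) :=
  (List.ofFn (fun i => List.replicate (p i) i)).flatten

theorem multirectRows_eq_map {l : ℕ} (p q : Fin l → ℕ) :
    multirectRows p q = (multirectBlocks p).map q := by
  simp only [multirectRows, multirectBlocks, List.map_flatten, List.map_ofFn]
  congr 2
  ext1 i
  simp

theorem mem_multirect {l : ℕ} {p q : Fin l → ℕ} {hq : Antitone q} {c : ℕ × ℕ} :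
    c ∈ multirect p q hq ↔
      ∃ h : c.1 < (multirectBlocks p).length, c.2 < q ((multirectBlocks p).get ⟨c.1, h⟩) := by
  rw [multirect, YoungDiagram.mem_ofRowLens]
  simp [multirectRows_eq_map]

theorem card_multirectBlocks_eq {l : ℕ} (p : Fin l → ℕ) (k : Fin l) :
    (Finset.univ.filter fun i => (multirectBlocks p).get i = k).card = p k := by
  have h := Fin.card_filter_univ_eq_vector_get_eq_count k
    (⟨multirectBlocks p, rfl⟩ : List.Vector (Fin l) _)
  have h2 : (multirectBlocks p).count k = p k := by
    rw [multirectBlocks, List.count_flatten, List.map_ofFn, List.sum_ofFn,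
      Finset.sum_eq_single k]
    · simp
    · intro b _ hb
      simp [List.count_replicate, hb]
    · simp
  rw [← h2]
  refine Eq.trans ?_ h
  congr 1

namespace NonorientedMap

section Embeddings
variable {α : Type*} (M : NonorientedMap α)

noncomputable instance : Fintype M.blackVertices :=
  ((Finset.finite_toSet _).image _ : M.blackVertices.Finite).fintype

noncomputable instance : Fintype M.whiteVertices :=
  ((Finset.finite_toSet _).image _ : M.whiteVertices.Finite).fintype

/-- The black vertex touched by an edge-side. -/
def blackAt (x : M.base) : M.blackVertices := ⟨orb {M.black.toPerm, M.edge.toPerm} x, x, x.2, rfl⟩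

/-- The white vertex touched by an edge-side. -/
def whiteAt (x : M.base) : M.whiteVertices := ⟨orb {M.white.toPerm, M.edge.toPerm} x, x, x.2, rfl⟩

theorem blackAt_surjective : Function.Surjective M.blackAt := by
  rintro ⟨_, x, hx, rfl⟩
  exact ⟨⟨x, hx⟩, rfl⟩

theorem whiteAt_surjective : Function.Surjective M.whiteAt := by
  rintro ⟨_, x, hx, rfl⟩
  exact ⟨⟨x, hx⟩, rfl⟩

theorem incident_orb_iff {s : Set (Equiv.Perm α)} (hs : M.edge.toPerm ∈ s) (x y : α) :
    Incident (orb s y) s(x, M.edge.toPerm x) ↔ orb s y = orb s x := by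
  simp only [Incident, Sym2.mem_iff, exists_eq_or_imp, exists_eq_left]
  rw [← MulAction.orbit_eq_iff, ← MulAction.orbit_eq_iff]
  change orb s x = orb s y ∨ orb s (M.edge.toPerm x) = orb s y ↔ _
  rw [orb_apply hs, or_self_iff, eq_comm]

theorem incident_black_iff (v : M.blackVertices) (x : M.base) :
    Incident v.1 s(x.1, M.edge.toPerm x) ↔ v = M.blackAt x := by
  obtain ⟨_, y, hy, rfl⟩ := v
  rw [Subtype.ext_iff]
  exact M.incident_orb_iff (by simp) x.1 y

theorem incident_white_iff (v : M.whiteVertices) (x : M.base) :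
    Incident v.1 s(x.1, M.edge.toPerm x) ↔ v = M.whiteAt x := by
  obtain ⟨_, y, hy, rfl⟩ := v
  rw [Subtype.ext_iff]
  exact M.incident_orb_iff (by simp) x.1 y

theorem exists_max_neighbour {l : ℕ} (φ : M.blackVertices → Fin l) (w : M.whiteVertices) :
    ∃ x : M.base, M.whiteAt x = w ∧
      ∀ y : M.base, M.whiteAt y = w → φ (M.blackAt y) ≤ φ (M.blackAt x) := by
  classical
  obtain ⟨x, hx⟩ := M.whiteAt_surjective w
  obtain ⟨x, hx, hmax⟩ := Finset.exists_max_image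
    (Finset.univ.filter fun x => M.whiteAt x = w) (fun x => φ (M.blackAt x)) ⟨x, by simpa using hx⟩
  exact ⟨x, by simpa using hx, fun y hy => hmax y (by simpa using hy)⟩

/-- The largest label of a neighbour of a white vertex. -/
noncomputable def maxLabel {l : ℕ} (φ : M.blackVertices → Fin l) (w : M.whiteVertices) : Fin l :=
  φ (M.blackAt (M.exists_max_neighbour φ w).choose)

theorem le_maxLabel {l : ℕ} (φ : M.blackVertices → Fin l) (x : M.base) :
    φ (M.blackAt x) ≤ M.maxLabel φ (M.whiteAt x) :=
  (M.exists_max_neighbour φ (M.whiteAt x)).choose_spec.2 x rfl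

/-- The contribution of `M` to the Stanley polynomial. -/
noncomputable def stanleyTerm (l : ℕ) : MvPolynomial (StanleyVar l) ℚ :=
  (-1) ^ M.blackVertices.ncard * ∑ φ : M.blackVertices → Fin l,
    (∏ b, MvPolynomial.X (StanleyVar.p (φ b))) *
      ∏ w, MvPolynomial.X (StanleyVar.q (M.maxLabel φ w))

theorem card_blackVertices : Fintype.card M.blackVertices = M.blackVertices.ncard := by
  rw [← Nat.card_eq_fintype_card, Nat.card_coe_set_eq]

theorem card_whiteVertices : Fintype.card M.whiteVertices = M.whiteVertices.ncard := by
  rw [← Nat.card_eq_fintype_card, Nat.card_coe_set_eq]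

theorem isHomogeneous_stanleyTerm (l : ℕ) : (M.stanleyTerm l).IsHomogeneous M.numVertices := by
  have hsign : ((-1 : MvPolynomial (StanleyVar l) ℚ) ^ M.blackVertices.ncard).IsHomogeneous 0 := by
    have := ((MvPolynomial.isHomogeneous_one (StanleyVar l) ℚ).neg).pow M.blackVertices.ncard
    rwa [zero_mul] at this
  rw [numVertices, add_comm, ← zero_add (_ + _)]
  refine hsign.mul (MvPolynomial.IsHomogeneous.sum _ _ _ fun φ _ => ?_)
  refine MvPolynomial.IsHomogeneous.mul ?_ ?_
  · rw [← card_blackVertices, Fintype.card_eq_sum_ones]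
    exact MvPolynomial.IsHomogeneous.prod _ _ _ fun b _ => MvPolynomial.isHomogeneous_X _ _
  · rw [← card_whiteVertices, Fintype.card_eq_sum_ones]
    exact MvPolynomial.IsHomogeneous.prod _ _ _ fun b _ => MvPolynomial.isHomogeneous_X _ _

variable [DecidableEq α]

/-- Incidence forces the box of an edge to be the row and column of its endpoints. Every vertex
touches an edge, so its row or column meets the diagram automatically. -/
theorem numEmbeddings_eq_card_labels (lam : YoungDiagram) :
    M.numEmbeddings lam = Nat.card {rc : (M.blackVertices → ℕ) × (M.whiteVertices → ℕ) //
      ∀ x, (rc.1 (M.blackAt x), rc.2 (M.whiteAt x)) ∈ lam} := by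
  have hbox : ∀ (f : M.Embedding lam) (x : M.base) (e) (he : s(x.1, M.edge.toPerm x) = e.1),
      (f.box e).1 = ((f.row (M.blackAt x)).1, (f.column (M.whiteAt x)).1) := by
    intro f x e he
    exact Prod.ext (f.black_incident _ e (he ▸ (M.incident_black_iff _ x).2 rfl))
      (f.white_incident _ e (he ▸ (M.incident_white_iff _ x).2 rfl))
  refine Nat.card_eq_of_bijective (fun f => ⟨(fun b => (f.row b).1, fun w => (f.column w).1),
    fun x => hbox f x ⟨_, Finset.mem_image_of_mem _ x.2⟩ rfl ▸ (f.box _).2⟩) ⟨?_, ?_⟩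
  · intro f g hfg
    have h := congrArg Subtype.val hfg
    have hr : f.row = g.row := funext fun b => Subtype.ext (congrFun (congrArg Prod.fst h) b)
    have hc : f.column = g.column := funext fun w => Subtype.ext (congrFun (congrArg Prod.snd h) w)
    have hb : f.box = g.box := by
      funext e
      obtain ⟨x, hx, hxe⟩ := Finset.mem_image.1 e.2
      apply Subtype.ext
      rw [hbox f ⟨x, hx⟩ e hxe, hbox g ⟨x, hx⟩ e hxe, hr, hc]
    cases f
    cases g
    simp only at hr hc hb
    subst hr hc hb
    rfl
  · rintro ⟨⟨r, c⟩, h⟩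
    have hex : ∀ e : {e // e ∈ M.edges}, ∃ x : M.base, s(x.1, M.edge.toPerm x) = e.1 := by
      intro e
      obtain ⟨x, hx, hxe⟩ := Finset.mem_image.1 e.2
      exact ⟨⟨x, hx⟩, hxe⟩
    choose side hside using hex
    refine ⟨⟨fun w => ⟨c w, ?_⟩, fun b => ⟨r b, ?_⟩,
      fun e => ⟨(r (M.blackAt (side e)), c (M.whiteAt (side e))), h _⟩, ?_, ?_⟩, rfl⟩
    · obtain ⟨x, rfl⟩ := M.whiteAt_surjective w
      exact lam.up_left_mem (Nat.zero_le _) le_rfl (h x)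
    · obtain ⟨x, rfl⟩ := M.blackAt_surjective b
      exact lam.up_left_mem le_rfl (Nat.zero_le _) (h x)
    · intro v e hv
      rw [← hside e, incident_white_iff] at hv
      rw [hv]
    · intro v e hv
      rw [← hside e, incident_black_iff] at hv
      rw [hv]

/-- Group the choices of rows by the rectangles φ they lie in. The column of a white vertex must fit
in the shortest row among its neighbours; as `q` is antitone, this row has the largest label. -/
theorem numEmbeddings_multirect {l : ℕ} (p q : Fin l → ℕ) (hq : Antitone q) :
    M.numEmbeddings (multirect p q hq) = ∑ φ : M.blackVertices → Fin l,
      (∏ b, p (φ b)) * ∏ w, q (M.maxLabel φ w) := by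
  classical
  set K := multirectBlocks p with hK
  have h1 : M.numEmbeddings (multirect p q hq) =
      Nat.card (Σ R : M.blackVertices → Fin K.length,
        ∀ w, Fin (q (M.maxLabel (fun b => K.get (R b)) w))) := by
    rw [numEmbeddings_eq_card_labels]
    refine (Nat.card_eq_of_bijective (fun Rc => ⟨(fun b => (Rc.1 b).1, fun w => (Rc.2 w).1),
      fun x => mem_multirect.2 ⟨(Rc.1 _).2,
        (Rc.2 (M.whiteAt x)).2.trans_le (hq (M.le_maxLabel (fun b => K.get (Rc.1 b)) x))⟩⟩)
      ⟨?_, ?_⟩).symm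
    · rintro ⟨R, c⟩ ⟨R', c'⟩ h
      have h := congrArg Subtype.val h
      obtain rfl : R = R' := funext fun b => Fin.ext (congrFun (congrArg Prod.fst h) b)
      obtain rfl : c = c' := funext fun w => Fin.ext (congrFun (congrArg Prod.snd h) w)
      rfl
    · rintro ⟨⟨r, c⟩, h⟩
      have hr : ∀ b, r b < K.length := by
        intro b
        obtain ⟨x, rfl⟩ := M.blackAt_surjective b
        exact (mem_multirect.1 (h x)).1
      refine ⟨⟨fun b => ⟨r b, hr b⟩, fun w => ⟨c w, ?_⟩⟩, rfl⟩
      have hex := M.exists_max_neighbour (fun b => K.get ⟨r b, hr b⟩) w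
      have := (mem_multirect.1 (h hex.choose)).2
      exact (congrArg c hex.choose_spec.1).symm.trans_lt this
  rw [h1, Nat.card_eq_fintype_card, Fintype.card_sigma]
  simp only [Fintype.card_pi, Fintype.card_fin]
  rw [← Finset.sum_fiberwise_of_maps_to (t := Finset.univ)
    (g := fun (R : M.blackVertices → Fin K.length) b => K.get (R b)) fun _ _ => Finset.mem_univ _]
  refine Finset.sum_congr rfl fun φ _ => ?_
  rw [Finset.sum_congr rfl (g := fun _ => ∏ w, q (M.maxLabel φ w)), Finset.sum_const, smul_eq_mul]
  · congr 1
    have : (Finset.univ.filter fun R : M.blackVertices → Fin K.length =>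
        (fun b => K.get (R b)) = φ) =
        Fintype.piFinset fun b => Finset.univ.filter fun i => K.get i = φ b := by
      ext R
      simp [funext_iff]
    rw [this, Fintype.card_piFinset]
    exact Finset.prod_congr rfl fun b _ => card_multirectBlocks_eq p (φ b)
  · intro R hR
    rw [(Finset.mem_filter.1 hR).2]

theorem normEmbeddings_multirect {l : ℕ} (p q : Fin l → ℕ) (hq : Antitone q) :
    M.normEmbeddings (multirect p q hq) =
      MvPolynomial.aeval (stanleyValue p q) (M.stanleyTerm l) := by
  rw [normEmbeddings, numEmbeddings_multirect, stanleyTerm, map_mul, map_pow, map_neg, map_one,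
    mul_assoc, map_sum]
  congr 1
  push_cast
  rw [Finset.mul_sum]
  refine Finset.sum_congr rfl fun φ _ => ?_
  simp only [map_mul, map_prod, MvPolynomial.aeval_X, stanleyValue, Finset.prod_mul_distrib,
    Finset.prod_const, Finset.card_univ, card_blackVertices, card_whiteVertices,
    LaurentPolynomial.T_pow]
  rw [show ((M.whiteVertices.ncard : ℤ) - M.blackVertices.ncard) =
    M.blackVertices.ncard * (-1) + M.whiteVertices.ncard * 1 by ring, LaurentPolynomial.T_add]
  ring

end Embeddings

end NonorientedMap

/-! ### Uniqueness of the Stanley polynomial and of the function -/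

instance {l : ℕ} : Finite (StanleyVar l) :=
  Finite.of_injective
    (fun v : StanleyVar l => (match v with
      | .gamma => none
      | .p i => some (Sum.inl i)
      | .q i => some (Sum.inr i) : Option (Fin l ⊕ Fin l)))
    (by rintro (_ | _ | _) (_ | _ | _) h <;> simp_all)

section Uniqueness
variable {l : ℕ}

/-- The values of the variables when `A = a`. -/
def rationalValue (a : ℚ) (p q : Fin l → ℕ) : StanleyVar l → ℚ
  | .gamma => a⁻¹ - a
  | .p i => p i * a⁻¹
  | .q i => q i * a

theorem eval_rationalValue_eq_zero {P : MvPolynomial (StanleyVar l) ℚ} {p q : Fin l → ℕ}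
    (h : MvPolynomial.aeval (stanleyValue p q) P = 0) {a : ℚ} (ha : a ≠ 0) :
    MvPolynomial.eval (rationalValue a p q) P = 0 := by
  have h2 := congrArg (LaurentPolynomial.eval₂ (RingHom.id ℚ) (Units.mk0 a ha)) h
  rw [map_zero, MvPolynomial.aeval_def, MvPolynomial.eval₂_eq_eval_map] at h2
  rw [← h2, MvPolynomial.eval_map, MvPolynomial.hom_eval₂, MvPolynomial.eval,
    MvPolynomial.coe_eval₂Hom]
  congr 1
  · exact Subsingleton.elim _ _
  · funext v
    cases v <;> simp [rationalValue, stanleyValue, gammaA, LaurentPolynomial.eval₂_T]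

theorem infinite_gamma_values : {g : ℚ | ∃ a : ℚ, a ≠ 0 ∧ a⁻¹ - a = g}.Infinite := by
  refine Set.infinite_of_injective_forall_mem (f := fun k : ℕ => ((k + 1 : ℚ))⁻¹ - (k + 1)) ?_ ?_
  · refine StrictAnti.injective fun i j hij => ?_
    have h : (i : ℚ) < j := by exact_mod_cast hij
    have h2 : ((j : ℚ) + 1)⁻¹ < ((i : ℚ) + 1)⁻¹ := by gcongr
    linarith
  · intro k
    exact ⟨k + 1, by positivity, rfl⟩

/-- A polynomial vanishing at all the values of the isotropic coordinates is zero. -/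
theorem eq_zero_of_aeval_stanleyValue {P : MvPolynomial (StanleyVar l) ℚ}
    (h : ∀ p q : Fin l → ℕ, Antitone q → MvPolynomial.aeval (stanleyValue p q) P = 0) : P = 0 := by
  classical
  -- γ and the scalings of p and q all depend on A, so A = a is frozen first; p and q then still
  -- fill a large enough grid.
  have hfix : ∀ a : ℚ, a ≠ 0 → MvPolynomial.bind₁
      (fun v : StanleyVar l => match v with
        | .gamma => MvPolynomial.C (a⁻¹ - a)
        | v => MvPolynomial.X v) P = 0 := by
    intro a ha
    set Q := MvPolynomial.bind₁ (fun v : StanleyVar l => match v with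
        | .gamma => MvPolynomial.C (a⁻¹ - a)
        | v => MvPolynomial.X v) P with hQ
    set D := Q.totalDegree + 1 with hD
    -- The windows for the q-variables are disjoint and decrease with the index, so independent
    -- choices in them always give an antitone `q`.
    refine MvPolynomial.eq_zero_of_eval_zero_at_prod_finset Q (fun v => match v with
      | .gamma => (Finset.range D).image (fun k : ℕ => (k : ℚ))
      | .p i => (Finset.range D).image (fun k : ℕ => (k : ℚ) * a⁻¹)
      | .q i => (Finset.range D).image (fun k : ℕ => (((l - i.1) * D + k : ℕ) : ℚ) * a)) ?_ ?_
    · intro v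
      refine (Nat.lt_succ_of_le (MvPolynomial.degreeOf_le_totalDegree Q v)).trans_le ?_
      cases v
      all_goals
        dsimp only
        rw [Finset.card_image_of_injective, Finset.card_range]
        intro i j hij
        simpa [ha] using hij
    · intro x hx
      have hp : ∀ i : Fin l, ∃ k : ℕ, (k : ℚ) * a⁻¹ = x (.p i) := fun i => by
        obtain ⟨k, -, hk⟩ := Finset.mem_image.1 (hx (.p i))
        exact ⟨k, hk⟩
      have hq : ∀ i : Fin l, ∃ k < D, (((l - i.1) * D + k : ℕ) : ℚ) * a = x (.q i) := fun i => by
        obtain ⟨k, hkD, hk⟩ := Finset.mem_image.1 (hx (.q i))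
        exact ⟨k, Finset.mem_range.1 hkD, hk⟩
      choose p hp using hp
      choose k hkD hk using hq
      have hanti : Antitone fun i : Fin l => (l - i.1) * D + k i := by
        intro i j hij
        rcases hij.eq_or_lt with rfl | hij
        · exact le_rfl
        · have h1 : (l - j.1) + 1 ≤ l - i.1 := by
            have := Fin.lt_def.1 hij
            omega
          have h2 := hkD j
          dsimp only
          nlinarith
      have := eval_rationalValue_eq_zero (h p _ hanti) ha
      rw [hQ, ← MvPolynomial.coe_aeval_eq_eval, RingHom.coe_coe, MvPolynomial.aeval_bind₁,
        ← this, ← MvPolynomial.coe_aeval_eq_eval, RingHom.coe_coe]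
      congr 2
      funext v
      cases v <;> simp [rationalValue, hp, ← hk]
  -- At every rational point whose γ-coordinate has the form a⁻¹ - a the polynomial now vanishes,
  -- and there are infinitely many such values.
  refine MvPolynomial.funext_set (fun v : StanleyVar l => match v with
    | .gamma => {g : ℚ | ∃ a : ℚ, a ≠ 0 ∧ a⁻¹ - a = g}
    | _ => Set.univ) ?_ ?_
  · rintro (_ | _ | _)
    · exact infinite_gamma_values
    · exact Set.infinite_univ
    · exact Set.infinite_univ
  · intro x hx
    obtain ⟨a, ha, hag⟩ := hx .gamma (Set.mem_univ _)
    have := congrArg (MvPolynomial.aeval x) (hfix a ha)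
    rw [MvPolynomial.aeval_bind₁, map_zero] at this
    rw [map_zero, ← this, ← MvPolynomial.coe_aeval_eq_eval, RingHom.coe_coe]
    congr 2
    funext v
    cases v <;> simp [hag]

theorem IsStanleyPolynomial.unique {F : YoungDiagram → LaurentPolynomial ℚ}
    {St St' : (l : ℕ) → MvPolynomial (StanleyVar l) ℚ} (h : IsStanleyPolynomial F St)
    (h' : IsStanleyPolynomial F St') : St' = St := by
  funext l
  rw [← sub_eq_zero]
  refine eq_zero_of_aeval_stanleyValue fun p q hq => ?_
  rw [map_sub, ← h l p q hq, ← h' l p q hq, sub_self]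

theorem exists_eq_multirect (lam : YoungDiagram) :
    ∃ (l : ℕ) (p q : Fin l → ℕ) (hq : Antitone q), lam = multirect p q hq := by
  -- One rectangle of height 1 for each row.
  refine ⟨lam.rowLens.length, fun _ => 1, lam.rowLens.get, lam.rowLens_sorted.antitone_get, ?_⟩
  have hrows : multirectRows (fun _ => 1) lam.rowLens.get = lam.rowLens := by
    have : (List.ofFn fun i => List.replicate 1 (lam.rowLens.get i)) =
        (List.ofFn lam.rowLens.get).map fun x => [x] := by
      rw [List.map_ofFn]
      rfl
    rw [multirectRows, this, List.ofFn_get, ← List.flatMap_def, List.flatMap_singleton']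
  rw [multirect]
  conv_lhs => rw [← YoungDiagram.ofRowLens_to_rowLens_eq_self (μ := lam)]
  congr 1
  exact hrows.symm

theorem IsStanleyPolynomial.function_unique {F G : YoungDiagram → LaurentPolynomial ℚ}
    {St : (l : ℕ) → MvPolynomial (StanleyVar l) ℚ} (hF : IsStanleyPolynomial F St)
    (hG : IsStanleyPolynomial G St) : F = G := by
  funext lam
  obtain ⟨l, p, q, hq, rfl⟩ := exists_eq_multirect lam
  rw [hF, hG]

end Uniqueness

/-! ### Homogeneous components -/

section Homogeneous
variable {σ : Type*}

theorem totalDegree_aeval_X_le {R : Type*} [CommSemiring R] (v : σ) (f : R[X]) :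
    (aeval (MvPolynomial.X v : MvPolynomial σ R) f).totalDegree ≤ f.natDegree := by
  rw [aeval_eq_sum_range]
  refine MvPolynomial.totalDegree_finsetSum_le fun i hi => ?_
  refine (MvPolynomial.totalDegree_smul_le _ _).trans ?_
  refine (MvPolynomial.isHomogeneous_X_pow v i).totalDegree_le.trans ?_
  exact Nat.lt_succ_iff.1 (Finset.mem_range.1 hi)

/-- Since `g` is homogeneous, only the term of degree `d` of `f` reaches degree `d + m`; `d` may
exceed the actual degree of `f`, and both sides are then zero. -/
theorem homogeneousComponent_aeval_X_mul {R : Type*} [CommSemiring R] (v : σ) {f : R[X]} {d m : ℕ}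
    (hf : f.natDegree ≤ d) {g : MvPolynomial σ R} (hg : g.IsHomogeneous m) :
    MvPolynomial.homogeneousComponent (d + m) (aeval (MvPolynomial.X v : MvPolynomial σ R) f * g) =
      MvPolynomial.C (f.coeff d) * MvPolynomial.X v ^ d * g := by
  rw [aeval_eq_sum_range' (Nat.lt_succ_of_le hf), Finset.sum_mul, map_sum, Finset.sum_eq_single d]
  · rw [MvPolynomial.smul_eq_C_mul]
    refine MvPolynomial.homogeneousComponent_eq_self ?_
    refine MvPolynomial.IsHomogeneous.mul ?_ hg
    exact MvPolynomial.isHomogeneous_C_mul_X_pow _ _ _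
  · intro i _ hi
    rw [MvPolynomial.smul_eq_C_mul, MvPolynomial.homogeneousComponent_of_mem
      ((MvPolynomial.isHomogeneous_C_mul_X_pow (f.coeff i) v i).mul hg), if_neg (by omega)]
  · intro h
    exact absurd (Finset.mem_range.2 (Nat.lt_succ_self d)) h

end Homogeneous

theorem corollary5p5 {α : Type*} [DecidableEq α] [Fintype α] (n : ℕ) (hn : 1 ≤ n)
    (hcard : Fintype.card α = 2 * n)
    (B W : Pairing (Finset.univ : Finset α)) (hface : (polygons B W).ncard = 1) :
    (∀ E : Pairing (Finset.univ : Finset α), (gluedMap B W E).numVertices ≤ n + 1) ∧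
    ∃ St : (l : ℕ) → MvPolynomial (StanleyVar l) ℚ,
      IsStanleyPolynomial (orientabilitySeries B W) St ∧
      (∀ St' : (l : ℕ) → MvPolynomial (StanleyVar l) ℚ,
        IsStanleyPolynomial (orientabilitySeries B W) St' → St' = St) ∧
      (∀ l, (St l).totalDegree ≤ n + 1) ∧
      ∀ top : YoungDiagram → LaurentPolynomial ℚ,
        IsStanleyPolynomial top (fun l => MvPolynomial.homogeneousComponent (n + 1) (St l)) ↔
          top = fun lam => -∑ E : Pairing (Finset.univ : Finset α),
            LaurentPolynomial.C (gluedMap B W E).monTop *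
              gammaA ^ (n + 1 - (gluedMap B W E).numVertices) *
              (gluedMap B W E).normEmbeddings lam := by
  have hV := numVertices_gluedMap_le hcard hface
  let St : (l : ℕ) → MvPolynomial (StanleyVar l) ℚ := fun l =>
    -∑ E : Pairing (Finset.univ : Finset α),
      aeval (MvPolynomial.X StanleyVar.gamma) (gluedMap B W E).mon * (gluedMap B W E).stanleyTerm l
  have hSt : IsStanleyPolynomial (orientabilitySeries B W) St := by
    intro l p q hq
    rw [orientabilitySeries, hface, pow_one, neg_one_mul, map_neg, map_sum]
    congr 1
    refine Finset.sum_congr rfl fun E _ => ?_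
    rw [map_mul, NonorientedMap.normEmbeddings_multirect, ← aeval_algHom_apply,
      MvPolynomial.aeval_X, stanleyValue]
  have htop : IsStanleyPolynomial (fun lam => -∑ E : Pairing (Finset.univ : Finset α),
      LaurentPolynomial.C (gluedMap B W E).monTop *
        gammaA ^ (n + 1 - (gluedMap B W E).numVertices) *
          (gluedMap B W E).normEmbeddings lam)
      (fun l => MvPolynomial.homogeneousComponent (n + 1) (St l)) := by
    intro l p q hq
    simp only [St]
    rw [map_neg, map_neg, map_sum, map_sum]
    congr 1
    refine Finset.sum_congr rfl fun E _ => ?_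
    have h := homogeneousComponent_aeval_X_mul StanleyVar.gamma
      (natDegree_mon_gluedMap_le hcard hface E) ((gluedMap B W E).isHomogeneous_stanleyTerm l)
    -- The bound on |V| makes the truncated subtraction exact: the power of γ and the degree of the
    -- embedding polynomial add up to n + 1.
    rw [Nat.sub_add_cancel (hV E), coeff_mon_gluedMap hcard hface] at h
    rw [h, map_mul, map_mul, map_pow, MvPolynomial.aeval_X, MvPolynomial.aeval_C,
      NonorientedMap.normEmbeddings_multirect, stanleyValue]
    rfl
  refine ⟨hV, St, hSt, fun St' => hSt.unique, fun l => ?_, fun top => ⟨fun h => ?_, ?_⟩⟩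
  · rw [MvPolynomial.totalDegree_neg]
    refine MvPolynomial.totalDegree_finsetSum_le fun E _ => ?_
    refine (MvPolynomial.totalDegree_mul _ _).trans ?_
    have h1 := (totalDegree_aeval_X_le (StanleyVar.gamma (l := l)) (gluedMap B W E).mon).trans
      (natDegree_mon_gluedMap_le hcard hface E)
    have h2 := ((gluedMap B W E).isHomogeneous_stanleyTerm l).totalDegree_le
    have h3 := hV E
    omega
  · exact h.function_unique htop
  · rintro rfl
    exact htop
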